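/- **Theorem (Jackson-type estimate for $E^{\alpha}_{m,n}(f)$).** Equip $\mathcal C([-1,1]^2,\mathbb R)$ with the uniform norm $\|\cdot\|_\infty$. *Setting.* Let $N,M\ge 2$, let $-1=x_0<x_1<\dots<x_N=1$ and $-1=y_0<y_1<\dots<y_M=1$ be a net $\Delta$, and put $I_i=[x_{i-1},x_i]$, $J_j=[y_{j-1},y_j]$. Let $u_i:[-1,1]\to I_i$ be the affine bijection that is increasing for odd $i$ and decreasing for even $i$, and let $v_j:[-1,1]\to J_j$ be defined likewise. Let $\alpha\in\mathcal C([-1,1]^2,\mathbb R)$ with $\|\alpha\|_\infty<1$, and let $L$ be a bounded linear operator on $\mathcal C([-1,1]^2,\mathbb R)$ such that $(Lg)(x,y)=g(x,y)$ for every $g$ and every $x,y\in\{-1,1\}$; write $\|L\|$, $\|Id-L\|$ for operator norms. For $g\in\mathcal C([-1,1]^2,\mathbb R)$, the fractal function $g^\alpha=\mathcal F^\alpha_{\Delta,L}(g)$ is the unique continuous function that agrees with $g$ at all $(x_i,y_j)$ and whose graph $G$ satisfies $G=\bigcup_{i,j}W_{ij}(G)$, where $$W_{ij}(x,y,z)=\big(u_i(x),v_j(y),\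 \alpha(u_i(x),v_j(y))\,z+g(u_i(x),v_j(y))-\alpha(u_i(x),v_j(y))\,(Lg)(x,y)\big).$$ For $m,n\ge1$ let $\mathcal P_{m,n}$ be either the set of all polynomials $\sum_{i=0}^m\sum_{j=0}^n a_{ij}x^iy^j$ with real coefficients, or the set of all real bivariate polynomials of total degree at most $m+n$, both regarded as functions on $[-1,1]^2$; the estimate holds for each of the two choices. Put $$E^{\alpha}_{m,n}(f)=\inf\{\|f-p^\alpha\|_\infty: p\in\mathcal P_{m,n}\}.$$ With $\phi(x)=\sqrt{1-x^2}$, the Ditzian–Totik modulus of smoothness is $$\omega_2^\phi(f;\delta_1,\delta_2)=\sup_{0<h_1\le\delta_1,\;0<h_2\le\delta_2}\ \sup_{(x,y)\in[-1,1]^2}\Big|\sum_{k=0}^{2}(-1)^k\tbinom2k f\big(x+h_1\phi(x)(1-k),\,y+h_2\phi(y)(1-k)\big)\Big|,$$ where the difference is taken to be $0$ unless $x\pm h_1\phi(x)\in[-1,1]$ and $y\pm h_2\phi(y)\in[-1,1]$. *Claim.* There is an absolute constant $C>0$ (independent of $f,m,n,\Delta,\alpha,L$) such that, in every such setting, for all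 $f\in\mathcal C([-1,1]^2,\mathbb R)$ and all integers $m,n\ge 1$, $$E^{\alpha}_{m,n}(f)\le C\,\frac{1+\|\alpha\|_\infty\big(\|Id-L\|-1\big)}{1-\|\alpha\|_\infty}\,\omega_2^{\phi}\Big(f;\frac1m,\frac1n\Big)+\frac{\|\alpha\|_\infty\|Id-L\|}{1-\|\alpha\|_\infty}\,\|f\|_\infty .$$ -/

import Mathlib

namespace BivariateFractal

noncomputable section

/-- The interval `[-1, 1]`. -/
abbrev Segment : Type := Set.Icc (-1 : ℝ) 1

/-- The square `[-1, 1]²`; `C(Square, ℝ)` carries the uniform norm. -/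
abbrev Square : Type := Segment × Segment

/-- A partition `-1 = x₀ < x₁ < ⋯ < x_N = 1` with `N ≥ 2`
(`N ≥ 2` is what makes the affine maps onto the subintervals contractive). -/
structure Grid where
  N : ℕ
  two_le : 2 ≤ N
  node : Fin (N + 1) → Segment
  strictMono : StrictMono node
  node_zero : (node 0 : ℝ) = -1
  node_last : (node (Fin.last N) : ℝ) = 1

namespace Grid

variable (P : Grid)

/-- Left end point of the `i`-th subinterval. The index `i : Fin N` starts at `0`, so it stands
for the subinterval usually numbered `i + 1`. -/
def lo (i : Fin P.N) : ℝ := P.node i.castSucc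

/-- Right end point of the `i`-th subinterval. -/
def hi (i : Fin P.N) : ℝ := P.node i.succ

lemma lo_lt_hi (i : Fin P.N) : P.lo i < P.hi i :=
  P.strictMono i.castSucc_lt_succ

/-- The affine homeomorphism of `[-1, 1]` onto the `i`-th subinterval: increasing on the first,
third, fifth, ... subinterval and decreasing on the others. -/
def cellMap (i : Fin P.N) (x : Segment) : Segment :=
  ⟨if Even (i : ℕ) then P.lo i + (x + 1) / 2 * (P.hi i - P.lo i)
    else P.hi i - (x + 1) / 2 * (P.hi i - P.lo i), by
    have h := P.lo_lt_hi i
    have h1 : -1 ≤ P.lo i := (P.node i.castSucc).2.1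
    have h2 : P.hi i ≤ 1 := (P.node i.succ).2.2
    have hx1 := x.2.1
    have hx2 := x.2.2
    split_ifs <;> constructor <;> nlinarith⟩

lemma lo_le_cellMap (i : Fin P.N) (x : Segment) : P.lo i ≤ P.cellMap i x := by
  have h := P.lo_lt_hi i
  have hx1 := x.2.1
  have hx2 := x.2.2
  simp only [cellMap]
  split_ifs <;> nlinarith

lemma cellMap_le_hi (i : Fin P.N) (x : Segment) : P.cellMap i x ≤ P.hi i := by
  have h := P.lo_lt_hi i
  have hx1 := x.2.1
  have hx2 := x.2.2
  simp only [cellMap]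
  split_ifs <;> nlinarith

lemma cellMap_injective (i : Fin P.N) {x y : Segment} (hxy : P.cellMap i x = P.cellMap i y) :
    x = y := by
  have h := sub_pos.2 (P.lo_lt_hi i)
  have hc := congrArg Subtype.val hxy
  simp only [cellMap] at hc
  apply Subtype.ext
  split_ifs at hc <;> (apply mul_right_cancel₀ h.ne'; linarith)

lemma continuous_cellMap (i : Fin P.N) : Continuous (P.cellMap i) := by
  apply Continuous.subtype_mk
  by_cases h : Even (i : ℕ)
  · simp only [h, if_true]; fun_prop
  · simp only [h, if_false]; fun_prop

/-- Each point of a subinterval is in the range of its affine map. -/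
lemma exists_cellMap_eq (i : Fin P.N) (t : Segment) (h1 : P.lo i ≤ t) (h2 : (t : ℝ) ≤ P.hi i) :
    ∃ x, P.cellMap i x = t := by
  have h := sub_pos.2 (P.lo_lt_hi i)
  by_cases he : Even (i : ℕ)
  · refine ⟨⟨2 * ((t - P.lo i) / (P.hi i - P.lo i)) - 1, ?_, ?_⟩, Subtype.ext ?_⟩
    · have : 0 ≤ (t - P.lo i) / (P.hi i - P.lo i) := div_nonneg (by linarith) h.le
      linarith
    · have : (t - P.lo i) / (P.hi i - P.lo i) ≤ 1 := by rw [div_le_one h]; linarith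
      linarith
    · simp only [cellMap, he, if_true]
      field_simp
      ring
  · refine ⟨⟨2 * ((P.hi i - t) / (P.hi i - P.lo i)) - 1, ?_, ?_⟩, Subtype.ext ?_⟩
    · have : 0 ≤ (P.hi i - t) / (P.hi i - P.lo i) := div_nonneg (by linarith) h.le
      linarith
    · have : (P.hi i - t) / (P.hi i - P.lo i) ≤ 1 := by rw [div_le_one h]; linarith
      linarith
    · simp only [cellMap, he, if_false]
      field_simp
      ring

lemma cellMap_surjective (t : Segment) : ∃ i x, P.cellMap i x = t := by
  classical
  have hN := P.two_le
  by_cases hex : ∃ i : Fin P.N, (t : ℝ) ≤ P.hi i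
  · have hne : (Finset.univ.filter fun i : Fin P.N => (t : ℝ) ≤ P.hi i).Nonempty := by
      obtain ⟨i, hi⟩ := hex
      exact ⟨i, by simpa using hi⟩
    obtain ⟨i, hi, hmin⟩ := Finset.exists_min_image _ (fun i => i) hne
    have hi' : (t : ℝ) ≤ P.hi i := by simpa using hi
    refine ⟨i, P.exists_cellMap_eq i t ?_ hi'⟩
    by_contra hlt
    push Not at hlt
    rcases Nat.eq_zero_or_pos (i : ℕ) with h0 | hpos
    · have : i.castSucc = 0 := Fin.ext (by simpa using h0)
      rw [lo, this, P.node_zero] at hlt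
      exact absurd t.2.1 (not_le.2 hlt)
    · have hm := hmin ⟨(i : ℕ) - 1, by omega⟩ (by
        simp only [Finset.mem_filter, Finset.mem_univ, true_and]
        have : (⟨(i : ℕ) - 1, by omega⟩ : Fin P.N).succ = i.castSucc :=
          Fin.ext (by simp; omega)
        rw [Grid.hi, this]
        exact hlt.le)
      have : (i : ℕ) ≤ (i : ℕ) - 1 := hm
      omega
  · push Not at hex
    have := hex ⟨P.N - 1, by omega⟩
    have hs : (⟨P.N - 1, by omega⟩ : Fin P.N).succ = Fin.last P.N :=
      Fin.ext (by simp; omega)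
    rw [Grid.hi, hs, P.node_last] at this
    exact absurd t.2.2 (not_le.2 this)

/-- Consecutive affine maps agree, as to preimages, at the common node. -/
lemma cellMap_eq_of_lt {i j : Fin P.N} (hij : i < j) {x y : Segment}
    (h : P.cellMap i x = P.cellMap j y) : x = y := by
  have hc : (P.cellMap i x : ℝ) = P.cellMap j y := congrArg Subtype.val h
  have h1 := P.cellMap_le_hi i x
  have h2 := P.lo_le_cellMap j y
  have hle : P.node i.succ ≤ P.node j.castSucc :=
    P.strictMono.monotone (by rw [Fin.le_def]; simpa using hij)
  have hle' : P.hi i ≤ P.lo j := hle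
  have e1 : (P.cellMap i x : ℝ) = P.hi i := by linarith
  have e2 : (P.cellMap j y : ℝ) = P.lo j := by linarith
  have hnode : P.node i.succ = P.node j.castSucc := Subtype.ext (by
    change P.hi i = P.lo j
    linarith)
  have hval := congrArg Fin.val (P.strictMono.injective hnode)
  simp only [Fin.val_succ, Fin.val_castSucc] at hval
  have hi := sub_pos.2 (P.lo_lt_hi i)
  have hj := sub_pos.2 (P.lo_lt_hi j)
  have hpar : Even (j : ℕ) ↔ ¬ Even (i : ℕ) := by rw [← hval, Nat.even_add_one]
  apply Subtype.ext
  simp only [cellMap] at e1 e2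
  by_cases he : Even (i : ℕ)
  · rw [if_pos he] at e1
    rw [if_neg (by rw [hpar]; exact not_not.2 he)] at e2
    have a : ((x : ℝ) + 1) / 2 = 1 := mul_right_cancel₀ hi.ne' (by linarith)
    have b : ((y : ℝ) + 1) / 2 = 1 := mul_right_cancel₀ hj.ne' (by linarith)
    linarith
  · rw [if_neg he] at e1
    rw [if_pos (hpar.2 he)] at e2
    have a : ((x : ℝ) + 1) / 2 = 0 := mul_right_cancel₀ hi.ne' (by linarith)
    have b : ((y : ℝ) + 1) / 2 = 0 := mul_right_cancel₀ hj.ne' (by linarith)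
    linarith

/-- The inverses of the affine maps glue to one continuous map of `[-1, 1]`. -/
lemma exists_fold : ∃ σ : C(Segment, Segment), ∀ i x, σ (P.cellMap i x) = x := by
  let U : Fin P.N × Segment → Segment := fun q => P.cellMap q.1 q.2
  have hU : Continuous U := by
    rw [continuous_prod_of_discrete_left]
    exact P.continuous_cellMap
  have hq : Topology.IsQuotientMap U :=
    hU.isClosedMap.isQuotientMap hU (fun t => by
      obtain ⟨i, x, h⟩ := P.cellMap_surjective t
      exact ⟨(i, x), h⟩)
  have hUq : Topology.IsQuotientMap (⟨U, hU⟩ : C(Fin P.N × Segment, Segment)) := hq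
  have hwd : ∀ a b : Fin P.N × Segment, U a = U b → a.2 = b.2 := by
    rintro ⟨i, x⟩ ⟨j, y⟩ h
    rcases lt_trichotomy i j with hij | hij | hij
    · exact P.cellMap_eq_of_lt hij h
    · subst hij
      exact P.cellMap_injective i h
    · exact (P.cellMap_eq_of_lt hij h.symm).symm
  refine ⟨hUq.lift ⟨Prod.snd, continuous_snd⟩ (fun a b h => hwd a b h), fun i x => ?_⟩
  have := DFunLike.congr_fun
    (hUq.lift_comp ⟨Prod.snd, continuous_snd⟩ (fun a b h => hwd a b h)) (i, x)
  exact this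

/-- An end point of `[-1, 1]`. -/
def endpoint (b : Bool) : Segment := if b then ⟨1, by norm_num⟩ else ⟨-1, by norm_num⟩

/-- Every node is the image of an end point of `[-1, 1]`. -/
lemma exists_cellMap_endpoint (k : Fin (P.N + 1)) :
    ∃ i b, P.cellMap i (endpoint b) = P.node k := by
  have hN := P.two_le
  have key : ∀ i : Fin P.N, (∃ b, P.cellMap i (endpoint b) = P.node i.castSucc) ∧
      ∃ b, P.cellMap i (endpoint b) = P.node i.succ := by
    intro i
    by_cases he : Even (i : ℕ)
    · refine ⟨⟨false, Subtype.ext ?_⟩, ⟨true, Subtype.ext ?_⟩⟩ <;>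
        simp [cellMap, he, endpoint, lo, hi]
    · refine ⟨⟨true, Subtype.ext ?_⟩, ⟨false, Subtype.ext ?_⟩⟩ <;>
        simp [cellMap, he, endpoint, lo, hi]
  by_cases hk : (k : ℕ) < P.N
  · obtain ⟨b, hb⟩ := (key ⟨k, hk⟩).1
    exact ⟨_, b, hb⟩
  · have hk2 := k.2
    obtain ⟨b, hb⟩ := (key ⟨P.N - 1, by omega⟩).2
    refine ⟨_, b, hb.trans (congrArg _ (Fin.ext ?_))⟩
    simp
    omega

lemma exists_node_eq_endpoint (b : Bool) : ∃ k, P.node k = endpoint b := by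
  cases b
  · exact ⟨0, Subtype.ext (by simp [P.node_zero, endpoint])⟩
  · exact ⟨Fin.last _, Subtype.ext (by simp [P.node_last, endpoint])⟩

end Grid

/-- `L f` agrees with `f` at the four corners of the square, for every `f`. -/
def InterpolatesCorners (L : C(Square, ℝ) →L[ℝ] C(Square, ℝ)) : Prop :=
  ∀ (f : C(Square, ℝ)) (p : Square), ((p.1 : ℝ) = -1 ∨ (p.1 : ℝ) = 1) →
    ((p.2 : ℝ) = -1 ∨ (p.2 : ℝ) = 1) → L f p = f p

/-- The map `(x, y) ↦ (u_i(x), v_j(y))` of the square onto the cell with index `(i, j)`. -/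
def cell (X Y : Grid) (i : Fin X.N) (j : Fin Y.N) (p : Square) : Square :=
  (X.cellMap i p.1, Y.cellMap j p.2)

/-- `F_ij(x, y, z) = α(u_i x, v_j y) z + f(u_i x, v_j y) - α(u_i x, v_j y) (L f)(x, y)`. -/
def ifsHeight (X Y : Grid) (α : C(Square, ℝ)) (L : C(Square, ℝ) →L[ℝ] C(Square, ℝ))
    (f : C(Square, ℝ)) (i : Fin X.N) (j : Fin Y.N) (p : Square) (z : ℝ) : ℝ :=
  α (cell X Y i j p) * z + f (cell X Y i j p) - α (cell X Y i j p) * L f p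

/-- The maps `W_ij(x, y, z) = (u_i(x), v_j(y), F_ij(x, y, z))` of the iterated function system. -/
def ifsMap (X Y : Grid) (α : C(Square, ℝ)) (L : C(Square, ℝ) →L[ℝ] C(Square, ℝ))
    (f : C(Square, ℝ)) (i : Fin X.N) (j : Fin Y.N) (q : Square × ℝ) : Square × ℝ :=
  (cell X Y i j q.1, ifsHeight X Y α L f i j q.1 q.2)

/-- The graph of `g`. -/
def graph (g : C(Square, ℝ)) : Set (Square × ℝ) := Set.range fun p => (p, g p)

/-- `g` is an `α`-fractal function of `f`: it interpolates `f` at all the nodes of the net, and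
its graph is the union of its images under the maps of the iterated function system. -/
def IsAlphaFractal (X Y : Grid) (α : C(Square, ℝ)) (L : C(Square, ℝ) →L[ℝ] C(Square, ℝ))
    (f g : C(Square, ℝ)) : Prop :=
  (∀ i j, g (X.node i, Y.node j) = f (X.node i, Y.node j)) ∧
    graph g = ⋃ (i : Fin X.N) (j : Fin Y.N), ifsMap X Y α L f i j '' graph g

lemma graph_eq_iff (X Y : Grid) (α : C(Square, ℝ)) (L : C(Square, ℝ) →L[ℝ] C(Square, ℝ))
    (f g : C(Square, ℝ)) :
    (graph g = ⋃ (i : Fin X.N) (j : Fin Y.N), ifsMap X Y α L f i j '' graph g) ↔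
      ∀ i j p, g (cell X Y i j p) = ifsHeight X Y α L f i j p (g p) := by
  constructor
  · intro h i j p
    have hm : ifsMap X Y α L f i j (p, g p) ∈ graph g := by
      rw [h]
      exact Set.mem_iUnion₂.2 ⟨i, j, _, ⟨p, rfl⟩, rfl⟩
    obtain ⟨q, hq⟩ := hm
    simp only [ifsMap, Prod.mk.injEq] at hq
    obtain ⟨h1, h2⟩ := hq
    rw [← h1, h2]
  · intro h
    ext q
    simp only [Set.mem_iUnion]
    constructor
    · rintro ⟨⟨s, t⟩, rfl⟩
      obtain ⟨i, x, rfl⟩ := X.cellMap_surjective s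
      obtain ⟨j, y, rfl⟩ := Y.cellMap_surjective t
      exact ⟨i, j, _, ⟨(x, y), rfl⟩, Prod.ext rfl (h i j (x, y)).symm⟩
    · rintro ⟨i, j, _, ⟨p, rfl⟩, rfl⟩
      exact ⟨cell X Y i j p, Prod.ext rfl (h i j p)⟩

theorem existsUnique_isAlphaFractal (X Y : Grid) (α : C(Square, ℝ))
    (L : C(Square, ℝ) →L[ℝ] C(Square, ℝ)) (hα : ‖α‖ < 1) (hL : InterpolatesCorners L)
    (f : C(Square, ℝ)) : ∃! g, IsAlphaFractal X Y α L f g := by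
  obtain ⟨σ, hσ⟩ := X.exists_fold
  obtain ⟨τ, hτ⟩ := Y.exists_fold
  let S : C(Square, Square) := σ.prodMap τ
  have hS : ∀ i j p, S (cell X Y i j p) = p := fun i j p => Prod.ext (hσ i p.1) (hτ j p.2)
  let T : C(Square, ℝ) → C(Square, ℝ) := fun g => f + α * (g - L f).comp S
  have hT : ContractingWith ⟨‖α‖, norm_nonneg α⟩ T := by
    refine ⟨by exact_mod_cast hα, LipschitzWith.of_dist_le_mul fun g h => ?_⟩
    change dist (T g) (T h) ≤ ‖α‖ * dist g h
    rw [ContinuousMap.dist_le (by positivity)]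
    intro p
    have e : T g p - T h p = α p * (g (S p) - h (S p)) := by simp [T]; ring
    rw [Real.dist_eq, e, abs_mul]
    exact mul_le_mul (α.norm_coe_le_norm p)
      ((Real.dist_eq _ _).symm.le.trans (ContinuousMap.dist_apply_le_dist _))
      (abs_nonneg _) (norm_nonneg _)
  have hfix : ∀ g, (∀ i j p, g (cell X Y i j p) = ifsHeight X Y α L f i j p (g p)) ↔
      Function.IsFixedPt T g := by
    intro g
    constructor
    · intro h
      ext ⟨s, t⟩
      obtain ⟨i, x, rfl⟩ := X.cellMap_surjective s
      obtain ⟨j, y, rfl⟩ := Y.cellMap_surjective t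
      have h1 := h i j (x, y)
      have h2 := hS i j (x, y)
      change T g (cell X Y i j (x, y)) = g (cell X Y i j (x, y))
      simp only [T, ContinuousMap.add_apply, ContinuousMap.mul_apply, ContinuousMap.comp_apply,
        ContinuousMap.sub_apply, h2, h1, ifsHeight]
      ring
    · intro h i j p
      have h1 := DFunLike.congr_fun h (cell X Y i j p)
      have h2 := hS i j p
      simp only [T, ContinuousMap.add_apply, ContinuousMap.mul_apply, ContinuousMap.comp_apply,
        ContinuousMap.sub_apply, h2] at h1
      rw [← h1, ifsHeight]
      ring
  refine ⟨hT.fixedPoint T, ⟨?_, ?_⟩, ?_⟩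
  · set g := hT.fixedPoint T
    have hg := (hfix g).2 hT.fixedPoint_isFixedPt
    have hcor : ∀ a b, L f (Grid.endpoint a, Grid.endpoint b) =
        f (Grid.endpoint a, Grid.endpoint b) := by
      intro a b
      apply hL
      · cases a <;> simp [Grid.endpoint]
      · cases b <;> simp [Grid.endpoint]
    let d : Bool × Bool → ℝ := fun c => |g (Grid.endpoint c.1, Grid.endpoint c.2) -
      f (Grid.endpoint c.1, Grid.endpoint c.2)|
    have hnode : ∀ k l, ∃ c, |g (X.node k, Y.node l) - f (X.node k, Y.node l)| ≤ ‖α‖ * d c := by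
      intro k l
      obtain ⟨i, a, ha⟩ := X.exists_cellMap_endpoint k
      obtain ⟨j, b, hb⟩ := Y.exists_cellMap_endpoint l
      have h1 := hg i j (Grid.endpoint a, Grid.endpoint b)
      have h2 : cell X Y i j (Grid.endpoint a, Grid.endpoint b) = (X.node k, Y.node l) :=
        Prod.ext ha hb
      rw [ifsHeight, h2, hcor] at h1
      refine ⟨(a, b), ?_⟩
      have e : g (X.node k, Y.node l) - f (X.node k, Y.node l) = α (X.node k, Y.node l) *
          (g (Grid.endpoint a, Grid.endpoint b) - f (Grid.endpoint a, Grid.endpoint b)) := by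
        rw [h1]; ring
      rw [e, abs_mul]
      exact mul_le_mul_of_nonneg_right (α.norm_coe_le_norm _) (abs_nonneg _)
    obtain ⟨c, hc⟩ := Finite.exists_max d
    have hd : d c ≤ 0 := by
      obtain ⟨k, hk⟩ := X.exists_node_eq_endpoint c.1
      obtain ⟨l, hl⟩ := Y.exists_node_eq_endpoint c.2
      obtain ⟨c', hc'⟩ := hnode k l
      rw [hk, hl] at hc'
      have h1 : d c ≤ ‖α‖ * d c := hc'.trans (mul_le_mul_of_nonneg_left (hc c') (norm_nonneg _))
      nlinarith
    intro k l
    obtain ⟨c', hc'⟩ := hnode k l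
    have h0 : d c' ≤ 0 := (hc c').trans hd
    have h1 : |g (X.node k, Y.node l) - f (X.node k, Y.node l)| ≤ 0 :=
      hc'.trans (mul_nonpos_of_nonneg_of_nonpos (norm_nonneg _) h0)
    exact sub_eq_zero.1 (abs_nonpos_iff.1 h1)
  · exact (graph_eq_iff X Y α L f _).2 ((hfix _).2 hT.fixedPoint_isFixedPt)
  · intro g hg
    exact hT.fixedPoint_unique ((hfix g).1 ((graph_eq_iff X Y α L f g).1 hg.2))

/-- The fractal operator `f ↦ f^α`, where `f^α` is the unique `α`-fractal function of `f`. -/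
def fractalOperator (X Y : Grid) (α : C(Square, ℝ)) (L : C(Square, ℝ) →L[ℝ] C(Square, ℝ))
    (hα : ‖α‖ < 1) (hL : InterpolatesCorners L) (f : C(Square, ℝ)) : C(Square, ℝ) :=
  (existsUnique_isAlphaFractal X Y α L hα hL f).choose

/-- The polynomial functions `∑_{i ≤ m} ∑_{j ≤ n} a_ij x^i y^j` on the square. -/
def polyCoord (m n : ℕ) : Set C(Square, ℝ) :=
  {p | ∃ a : ℕ → ℕ → ℝ, ∀ q : Square, p q =
    ∑ i ∈ Finset.range (m + 1), ∑ j ∈ Finset.range (n + 1),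
      a i j * (q.1 : ℝ) ^ i * (q.2 : ℝ) ^ j}

/-- The polynomial functions of total degree at most `m + n` on the square. -/
def polyTotal (m n : ℕ) : Set C(Square, ℝ) :=
  {p | ∃ P : MvPolynomial (Fin 2) ℝ, P.totalDegree ≤ m + n ∧
    ∀ q : Square, p q = MvPolynomial.eval ![(q.1 : ℝ), (q.2 : ℝ)] P}

/-- Error of best uniform approximation of `f` from a set `V`. -/
def approxError (V : Set C(Square, ℝ)) (f : C(Square, ℝ)) : ℝ :=
  sInf ((fun g => ‖f - g‖) '' V)

/-- The weight `φ(x) = √(1 - x²)`. -/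
def phi (x : ℝ) : ℝ := √(1 - x ^ 2)

/-- The `r`-th symmetric difference of `f` at `(x, y)` with steps `h₁ φ(x)` and `h₂ φ(y)`, equal to
`0` when `(x ± r h₁ φ(x) / 2, y ± r h₂ φ(y) / 2)` are not all in the square. In the first case all
the points where `f` is evaluated lie in the square, so `Set.projIcc` leaves them unchanged. -/
def symmDifference (r : ℕ) (h₁ h₂ : ℝ) (f : C(Square, ℝ)) (p : Square) : ℝ :=
  open Classical in
  let x : ℝ := p.1
  let y : ℝ := p.2
  if x + r * h₁ * phi x / 2 ∈ Set.Icc (-1 : ℝ) 1 ∧ x - r * h₁ * phi x / 2 ∈ Set.Icc (-1 : ℝ) 1 ∧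
      y + r * h₂ * phi y / 2 ∈ Set.Icc (-1 : ℝ) 1 ∧ y - r * h₂ * phi y / 2 ∈ Set.Icc (-1 : ℝ) 1
  then ∑ k ∈ Finset.range (r + 1), (-1 : ℝ) ^ k * (r.choose k : ℝ) *
    f (Set.projIcc (-1 : ℝ) 1 (by norm_num) (x + h₁ * phi x * ((r : ℝ) / 2 - k)),
      Set.projIcc (-1 : ℝ) 1 (by norm_num) (y + h₂ * phi y * ((r : ℝ) / 2 - k)))
  else 0

/-- The bivariate Ditzian–Totik modulus of smoothness `ω_r^φ(f; δ₁, δ₂)`: the supremum of the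
absolute symmetric differences over `0 < h₁ ≤ δ₁`, `0 < h₂ ≤ δ₂` and all points of the square. -/
def modulus (r : ℕ) (f : C(Square, ℝ)) (δ₁ δ₂ : ℝ) : ℝ :=
  sSup {d | ∃ (h₁ h₂ : ℝ) (p : Square), 0 < h₁ ∧ h₁ ≤ δ₁ ∧ 0 < h₂ ∧ h₂ ≤ δ₂ ∧
    d = |symmDifference r h₁ h₂ f p|}

end

end BivariateFractal

open BivariateFractal

/-! The fractal part is a perturbation argument. The self-referential equation says that, on each
cell, `p^α - p` equals `α` times `(p^α - p) + (p - L p)` pulled back to the whole square. Taking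
norms gives `‖p^α - p‖ ≤ ‖α‖ ‖Id - L‖ / (1 - ‖α‖) * ‖p‖` (`norm_fractalOperator_sub_le`). If `‖f -
p‖ ≤ K ω`, then `‖p‖ ≤ ‖f‖ + K ω`, and the triangle inequality gives the claim with `C = K`, because
`1 + ‖α‖ D / (1 - ‖α‖) = (1 + ‖α‖ (D - 1)) / (1 - ‖α‖)` for `D = ‖Id - L‖`. A polynomial of
coordinate degree `(m, n)` has total degree at most `m + n`, so one `p` serves both choices of
polynomial space.

What remains is a Jackson theorem on the square (`exists_mem_polyCoord_norm_sub_le`). It follows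
from a univariate one (`exists_linear_approximation`) in which the approximant depends linearly on
finitely many values of `f`, so that operators in `x` and in `y` can be composed.

In one variable, `f` is first replaced by its piecewise linear interpolant at the nodes `-cos
(kπ/M)`, `M = 4m`. The interpolation error and the jumps of slope are controlled by second
differences with steps at most `φ(x)/m`. The interpolant is a combination of truncated lines `(x -
y_k)₊`, and each of these is replaced by a polynomial. After summation by parts the error is a sum
of (slope jump at `y_k`) times (error for `(x - y_k)₊`). The first factor is `O(W M / sin θ_k)` and
the second `O(sin θ_k / M)` with inverse square decay in the index distance, so the sum is `O(W)`.

The polynomials near `(x - z)₊` are antiderivatives of smoothed step functions, which are integrals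
of a Jackson kernel, the normalised cube of a Fejér kernel, over a window `[θ - t, θ + t]`. -/

open BivariateFractal

/-! ### Trigonometric kernels and smoothed step functions -/

open Polynomial in
/-- Functions of the form `∫_{θ-t}^{θ+t} Q(cos s) ds` are polynomials in `cos θ`. -/
lemma exists_polynomial_integral_cos (t : ℝ) (d : ℕ) (Q : ℝ[X]) (hQ : Q.natDegree ≤ d) :
    ∃ T : ℝ[X], T.natDegree ≤ d ∧
      ∀ θ : ℝ, T.eval (Real.cos θ) = ∫ s in (θ - t)..(θ + t), Q.eval (Real.cos s) := by
  induction d generalizing Q with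
  | zero =>
    obtain ⟨c, rfl⟩ : ∃ c, Q = C c := ⟨_, eq_C_of_natDegree_le_zero hQ⟩
    refine ⟨C (2 * t * c), (natDegree_C _).le, fun θ => ?_⟩
    simp only [eval_C, intervalIntegral.integral_const, smul_eq_mul]
    ring
  | succ d ih =>
    have hT : (Chebyshev.T ℝ (d + 1 : ℤ)).natDegree = d + 1 := by
      rw [Chebyshev.natDegree_T]; omega
    have hlc : (Chebyshev.T ℝ (d + 1 : ℤ)).coeff (d + 1) ≠ 0 := by
      conv => enter [1, 2]; rw [← hT]
      exact leadingCoeff_ne_zero.2 (Chebyshev.T_ne_zero ℝ _)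
    -- Subtracting this multiple of the Chebyshev polynomial lowers the degree; on `cos ((d + 1) s)`
    -- itself the window integral acts as a scalar.
    set c : ℝ := Q.coeff (d + 1) / (Chebyshev.T ℝ (d + 1 : ℤ)).coeff (d + 1) with hc
    obtain ⟨S, hSd, hS⟩ := ih (Q - C c * Chebyshev.T ℝ (d + 1 : ℤ)) (by
      have h1 : (Q - C c * Chebyshev.T ℝ (d + 1 : ℤ)).natDegree ≤ d + 1 :=
        (natDegree_sub_le _ _).trans (max_le hQ ((natDegree_C_mul_le _ _).trans hT.le))
      rw [natDegree_le_iff_coeff_eq_zero] at h1 ⊢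
      intro k hk
      rcases Nat.lt_or_ge (d + 1) k with h | h
      · exact h1 k h
      · obtain rfl : k = d + 1 := by omega
        rw [coeff_sub, coeff_C_mul, hc, div_mul_cancel₀ _ hlc, sub_self])
    refine ⟨S + C (c * (2 * Real.sin ((d + 1) * t) / (d + 1))) * Chebyshev.T ℝ (d + 1 : ℤ),
      ?_, fun θ => ?_⟩
    · exact (natDegree_add_le _ _).trans
        (max_le (hSd.trans (by omega)) ((natDegree_C_mul_le _ _).trans hT.le))
    have hd : (d + 1 : ℝ) ≠ 0 := by positivity
    have hint : ∫ s in (θ - t)..(θ + t), Real.cos ((d + 1) * s) =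
        2 * Real.sin ((d + 1) * t) / (d + 1) * Real.cos ((d + 1) * θ) := by
      rw [intervalIntegral.integral_comp_mul_left (fun s => Real.cos s) hd, integral_cos,
        mul_add, mul_sub, Real.sin_add, Real.sin_sub, smul_eq_mul]
      field_simp
      ring
    have hsplit : ∀ s : ℝ, Q.eval (Real.cos s) =
        (Q - C c * Chebyshev.T ℝ (d + 1 : ℤ)).eval (Real.cos s) + c * Real.cos ((d + 1) * s) := by
      intro s
      have := Chebyshev.T_real_cos s (d + 1 : ℤ)
      push_cast at this
      simp [this]
    have hT' := Chebyshev.T_real_cos θ (d + 1 : ℤ)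
    push_cast at hT'
    simp_rw [hsplit]
    rw [intervalIntegral.integral_add, intervalIntegral.integral_const_mul, hint, eval_add,
      hS, eval_mul, eval_C, hT']
    · ring
    · exact Continuous.intervalIntegrable (by fun_prop) _ _
    · exact Continuous.intervalIntegrable (by fun_prop) _ _

lemma abs_sin_natCast_mul_le (n : ℕ) (x : ℝ) : |Real.sin (n * x)| ≤ n * |Real.sin x| := by
  induction n with
  | zero => simp
  | succ n ih =>
    have e : ((n + 1 : ℕ) : ℝ) * x = n * x + x := by push_cast; ring
    rw [e, Real.sin_add]
    calc _ ≤ |Real.sin (n * x)| * |Real.cos x| + |Real.cos (n * x)| * |Real.sin x| := by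
          rw [← abs_mul, ← abs_mul]; exact abs_add_le _ _
      _ ≤ |Real.sin (n * x)| * 1 + 1 * |Real.sin x| := by
          gcongr <;> exact Real.abs_cos_le_one _
      _ ≤ _ := by push_cast; linarith

lemma one_sub_cos_natCast_mul_le (n : ℕ) (x : ℝ) :
    1 - Real.cos (n * x) ≤ n ^ 2 * (1 - Real.cos x) := by
  have h : ∀ y : ℝ, 1 - Real.cos y = 2 * Real.sin (y / 2) ^ 2 := fun y => by
    have := Real.cos_two_mul (y / 2)
    rw [mul_div_cancel₀ _ (two_ne_zero)] at this
    have h2 := Real.sin_sq_add_cos_sq (y / 2)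
    linarith
  rw [h, h, mul_div_assoc, ← sq_abs, ← sq_abs (Real.sin (x / 2))]
  have := pow_le_pow_left₀ (abs_nonneg _) (abs_sin_natCast_mul_le n (x / 2)) 2
  rw [mul_pow] at this
  linarith

open Polynomial in
/-- The Fejér kernel `(1 - cos Ns) / (1 - cos s)` as a polynomial in `cos s`. -/
lemma exists_fejer_polynomial (N : ℕ) (hN : 1 ≤ N) :
    ∃ q : ℝ[X], q.natDegree ≤ N - 1 ∧
      (∀ s : ℝ, (1 - Real.cos s) * q.eval (Real.cos s) = 1 - Real.cos (N * s)) ∧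
      ∀ s : ℝ, 0 ≤ q.eval (Real.cos s) ∧ q.eval (Real.cos s) ≤ N ^ 2 := by
  obtain ⟨r, hr⟩ : (X - C (1 : ℝ)) ∣ (Chebyshev.T ℝ N - 1) := by
    rw [dvd_iff_isRoot]; simp
  have hdeg : r.natDegree ≤ N - 1 := by
    rcases eq_or_ne r 0 with h | h
    · simp [h]
    have h1 := congrArg natDegree hr
    rw [natDegree_mul (X_sub_C_ne_zero 1) h, natDegree_X_sub_C] at h1
    have h2 := natDegree_sub_le (Chebyshev.T ℝ N) 1
    rw [Chebyshev.natDegree_T, natDegree_one] at h2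
    simp at h2
    omega
  have hid : ∀ s : ℝ, (1 - Real.cos s) * r.eval (Real.cos s) = 1 - Real.cos (N * s) := by
    intro s
    have h1 := congrArg (eval (Real.cos s)) hr
    have h2 := Chebyshev.T_real_cos s (N : ℤ)
    push_cast at h2
    simp only [eval_sub, h2, eval_mul, eval_X, eval_C, eval_one] at h1
    linarith
  refine ⟨r, hdeg, hid, ?_⟩
  -- The identity can be divided by `1 - x` only for `x < 1`; the bounds reach `x = 1` by
  -- continuity.
  have hlt : Set.Ico (-1 : ℝ) 1 ⊆ {x | r.eval x ∈ Set.Icc (0 : ℝ) (N ^ 2)} := by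
    intro x hx
    have hid := hid (Real.arccos x)
    have hup := one_sub_cos_natCast_mul_le N (Real.arccos x)
    have hc := Real.cos_le_one (N * Real.arccos x)
    rw [Real.cos_arccos hx.1 hx.2.le] at hid hup
    have hpos : 0 < 1 - x := by linarith [hx.2]
    constructor
    · by_contra h
      push Not at h
      nlinarith
    · by_contra h
      push Not at h
      nlinarith
  have hcl : IsClosed {x | r.eval x ∈ Set.Icc (0 : ℝ) (N ^ 2)} :=
    isClosed_Icc.preimage r.continuous
  have hIcc := hcl.closure_subset_iff.2 hlt
  rw [closure_Ico (by norm_num)] at hIcc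
  exact fun s => hIcc ⟨Real.neg_one_le_cos s, Real.cos_le_one s⟩

open Polynomial in
/-- Jackson type kernels: nonnegative trigonometric polynomials of mean one that are concentrated
near the origin. -/
lemma exists_jackson_kernel : ∃ C : ℝ, 0 < C ∧ ∀ N : ℕ, 1 ≤ N → ∃ Q : ℝ[X],
    Q.natDegree ≤ 3 * (N - 1) ∧ (∀ s : ℝ, 0 ≤ Q.eval (Real.cos s)) ∧
    (∫ s in (-Real.pi)..Real.pi, Q.eval (Real.cos s)) = 1 ∧
    ∀ s ∈ Set.Icc 0 Real.pi, Q.eval (Real.cos s) ≤ C * N / (1 + N * s) ^ 6 := by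
  have hpi := Real.pi_gt_three
  have hpi4 := Real.pi_le_four
  -- The kernel is `q ^ 3 / I`. The constant is `(4 * 256) ^ 3`, with `4 ^ 3` from the lower bound
  -- for `I` and `256 ^ 3` from the pointwise bound for `q`. Of the six powers of decay, two
  -- integrations and a sine weight will use three. A mere square would leave a single power, which
  -- is not summable.
  refine ⟨(64 * 16) ^ 3, by positivity, fun N hN => ?_⟩
  obtain ⟨q, hqd, hq, hqb⟩ := exists_fejer_polynomial N hN
  have hN' : (1 : ℝ) ≤ N := by exact_mod_cast hN
  have hcont : Continuous fun s : ℝ => q.eval (Real.cos s) ^ 3 := by fun_prop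
  set I := ∫ s in (-Real.pi)..Real.pi, q.eval (Real.cos s) ^ 3 with hI
  -- On `[0, 1/N]` one has `1 - cos s ≤ s² / 2` and `1 - cos (N s) ≥ (N s)² / 8`, hence `q ≥ N² / 4`
  -- there.
  have hlow : (N : ℝ) ^ 5 / 4 ^ 3 ≤ I := by
    have h1 : ∫ s in (0 : ℝ)..(1 / N), ((N : ℝ) ^ 2 / 4) ^ 3 ≤
        ∫ s in (0 : ℝ)..(1 / N), q.eval (Real.cos s) ^ 3 := by
      apply intervalIntegral.integral_mono_on_of_le_Ioo (by positivity)
        (Continuous.intervalIntegrable (by fun_prop) _ _) (hcont.intervalIntegrable _ _)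
      intro s hs
      have hNs : N * s ≤ 1 := by
        have := hs.2.le
        rw [le_div_iff₀ (by positivity)] at this
        linarith
      have hs0 : 0 < s := hs.1
      have hc1 := Real.one_sub_sq_div_two_le_cos (x := s)
      have hc2 := Real.cos_le_one_sub_mul_cos_sq (x := N * s)
        (by rw [abs_of_nonneg (by positivity)]; linarith)
      have hc3 : (N * s) ^ 2 / 8 ≤ 2 / Real.pi ^ 2 * (N * s) ^ 2 := by
        have : (1 : ℝ) / 8 ≤ 2 / Real.pi ^ 2 := by
          rw [div_le_div_iff₀ (by norm_num) (by positivity)]; nlinarith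
        nlinarith [sq_nonneg (N * s)]
      have hid := hq s
      apply pow_le_pow_left₀ (by positivity)
      have hq0 := (hqb s).1
      have h5 : (1 - Real.cos s) * q.eval (Real.cos s) ≤ s ^ 2 / 2 * q.eval (Real.cos s) := by
        gcongr; linarith
      have h6 : s ^ 2 / 2 * (N ^ 2 / 4) ≤ s ^ 2 / 2 * q.eval (Real.cos s) := by
        calc _ = (N * s) ^ 2 / 8 := by ring
          _ ≤ _ := by linarith
      exact le_of_mul_le_mul_left h6 (by positivity)
    have h2 : ∫ s in (0 : ℝ)..(1 / N), q.eval (Real.cos s) ^ 3 ≤ I := by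
      apply intervalIntegral.integral_mono_interval (by linarith) (by positivity)
      · calc (1 : ℝ) / N ≤ 1 := by rw [div_le_one (by positivity)]; exact hN'
          _ ≤ _ := by linarith
      · exact Filter.Eventually.of_forall fun s => pow_nonneg (hqb s).1 3
      · exact hcont.intervalIntegrable _ _
    refine le_trans (le_of_eq ?_) (h1.trans h2)
    rw [intervalIntegral.integral_const]
    simp
    field_simp
  have hIpos : 0 < I := lt_of_lt_of_le (by positivity) hlow
  refine ⟨C (1 / I) * q ^ 3, ?_, fun s => ?_, ?_, fun s hs => ?_⟩
  · refine (natDegree_C_mul_le _ _).trans (natDegree_pow_le.trans ?_)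
    gcongr
  · simp only [eval_mul, eval_C, eval_pow]
    have := (hqb s).1
    positivity
  · simp only [eval_mul, eval_C, eval_pow]
    rw [intervalIntegral.integral_const_mul, ← hI]
    field_simp
  · have hs0 : 0 ≤ s := hs.1
    have hq0 := (hqb s).1
    have hbd : q.eval (Real.cos s) ≤ 256 * N ^ 2 / (1 + N * s) ^ 2 := by
      rw [le_div_iff₀ (by positivity)]
      rcases le_total (N * s) 1 with h | h
      · have : (1 + N * s) ^ 2 ≤ 2 ^ 2 := by
          apply pow_le_pow_left₀ (by positivity); linarith
        calc _ ≤ (N : ℝ) ^ 2 * 2 ^ 2 := by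
              gcongr; exact (hqb s).2
          _ ≤ _ := by nlinarith [sq_nonneg (N : ℝ)]
      · have hc := Real.cos_le_one_sub_mul_cos_sq (x := s) (by rw [abs_of_nonneg hs0]; exact hs.2)
        have hc3 : s ^ 2 / 8 ≤ 2 / Real.pi ^ 2 * s ^ 2 := by
          have : (1 : ℝ) / 8 ≤ 2 / Real.pi ^ 2 := by
            rw [div_le_div_iff₀ (by norm_num) (by positivity)]; nlinarith
          nlinarith [sq_nonneg s]
        have h1 : s ^ 2 / 8 * q.eval (Real.cos s) ≤ 2 := by
          calc _ ≤ (1 - Real.cos s) * q.eval (Real.cos s) := by gcongr; linarith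
            _ ≤ 2 := by rw [hq]; linarith [Real.neg_one_le_cos (N * s)]
        have h2 : (1 + N * s) ^ 2 ≤ (2 * (N * s)) ^ 2 := by
          apply pow_le_pow_left₀ (by positivity); linarith
        calc _ ≤ q.eval (Real.cos s) * (2 * (N * s)) ^ 2 := by gcongr
          _ = 32 * N ^ 2 * (s ^ 2 / 8 * q.eval (Real.cos s)) := by ring
          _ ≤ 32 * N ^ 2 * 2 := by gcongr
          _ ≤ _ := by nlinarith [sq_nonneg (N : ℝ)]
    simp only [eval_mul, eval_C, eval_pow]
    calc _ ≤ 1 / ((N : ℝ) ^ 5 / 4 ^ 3) * (256 * N ^ 2 / (1 + N * s) ^ 2) ^ 3 := by gcongr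
      _ = _ := by field_simp; norm_num

lemma integral_div_pow_le {N a b c : ℝ} (k : ℕ) (hk : 1 ≤ k) (hN : 0 ≤ N) (hca : c ≤ a)
    (hab : a ≤ b) :
    ∫ u in a..b, N / (1 + N * (u - c)) ^ (k + 1) ≤ 1 / (1 + N * (a - c)) ^ k := by
  have hpos : ∀ u, a ≤ u → 0 < 1 + N * (u - c) := fun u hu => by
    have : 0 ≤ N * (u - c) := mul_nonneg hN (by linarith)
    linarith
  have hk0 : (0 : ℝ) < k := by exact_mod_cast hk
  have hderiv : ∀ u ∈ Set.uIcc a b, HasDerivAt (fun u => -(1 / k) * ((1 + N * (u - c)) ^ k)⁻¹)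
      (N / (1 + N * (u - c)) ^ (k + 1)) u := by
    intro u hu
    rw [Set.uIcc_of_le hab] at hu
    have hp := hpos u hu.1
    have h1 : HasDerivAt (fun u => 1 + N * (u - c)) N u := by
      simpa using (((hasDerivAt_id u).sub_const c).const_mul N).const_add 1
    refine (((h1.fun_pow k).fun_inv (pow_ne_zero _ hp.ne')).const_mul
      (-(1 / (k : ℝ)))).congr_deriv ?_
    obtain ⟨j, rfl⟩ : ∃ j, k = j + 1 := ⟨k - 1, by omega⟩
    field_simp
    simp only [Nat.add_sub_cancel]
    ring
  have hcont : ContinuousOn (fun u => N / (1 + N * (u - c)) ^ (k + 1)) (Set.uIcc a b) := by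
    apply ContinuousOn.div continuousOn_const (by fun_prop)
    intro u hu
    rw [Set.uIcc_of_le hab] at hu
    exact pow_ne_zero _ (hpos u hu.1).ne'
  rw [intervalIntegral.integral_eq_sub_of_hasDerivAt hderiv hcont.intervalIntegrable]
  have ha := hpos a le_rfl
  have hb := hpos b hab
  have h1 : 0 ≤ 1 / (k : ℝ) * ((1 + N * (b - c)) ^ k)⁻¹ := by positivity
  have h2 : 1 / (k : ℝ) * ((1 + N * (a - c)) ^ k)⁻¹ ≤ 1 * ((1 + N * (a - c)) ^ k)⁻¹ := by
    gcongr
    rw [div_le_one hk0]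
    exact_mod_cast hk
  have e : 1 / (1 + N * (a - c)) ^ k = ((1 + N * (a - c)) ^ k)⁻¹ := one_div _
  rw [e]
  linarith

open Polynomial in
/-- Algebraic polynomials in `cos θ` close to the indicator function of `θ < t`. -/
lemma exists_smooth_cutoff : ∃ C : ℝ, 0 < C ∧ ∀ N : ℕ, 1 ≤ N → ∃ T : ℝ → ℝ[X],
    (∀ t, (T t).natDegree ≤ 3 * (N - 1)) ∧
    (Continuous fun p : ℝ × ℝ => (T p.1).eval (Real.cos p.2)) ∧
    (∀ θ, (T 0).eval (Real.cos θ) = 0) ∧ (∀ θ, (T Real.pi).eval (Real.cos θ) = 1) ∧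
    ∀ t ∈ Set.Icc 0 Real.pi, ∀ θ ∈ Set.Icc 0 Real.pi,
      0 ≤ (T t).eval (Real.cos θ) ∧ (T t).eval (Real.cos θ) ≤ 1 ∧
      (t ≤ θ → (T t).eval (Real.cos θ) ≤ C / (1 + N * (θ - t)) ^ 5) ∧
      (θ ≤ t → 1 - (T t).eval (Real.cos θ) ≤ C / (1 + N * (t - θ)) ^ 5) := by
  obtain ⟨C, hC, hker⟩ := exists_jackson_kernel
  refine ⟨2 * C, by positivity, fun N hN => ?_⟩
  obtain ⟨Q, hQd, hQ0, hQ1, hQb⟩ := hker N hN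
  have hN' : (0 : ℝ) ≤ N := Nat.cast_nonneg N
  -- `T t` at `cos θ` is the mass of the kernel on `[θ - t, θ + t]`. It tends to be near one when
  -- the window contains the origin, and near zero otherwise.
  choose T hTd hT using fun t => exists_polynomial_integral_cos t (3 * (N - 1)) Q hQd
  set K : ℝ → ℝ := fun s => Q.eval (Real.cos s) with hK
  have hKc : Continuous K := by fun_prop
  have hKi : ∀ a b, IntervalIntegrable K MeasureTheory.volume a b :=
    fun a b => hKc.intervalIntegrable a b
  have hper : Function.Periodic K (2 * Real.pi) := fun s => by
    simp only [hK, Real.cos_add_two_pi]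
  have hfull : ∀ a, ∫ s in a..(a + 2 * Real.pi), K s = 1 := by
    intro a
    rw [hper.intervalIntegral_add_eq a (-Real.pi), ← hQ1]
    congr 1; ring
  have htail : ∀ s ∈ Set.Icc 0 Real.pi, ∫ u in s..(2 * Real.pi - s), K u ≤
      2 * C / (1 + N * s) ^ 5 := by
    intro s hs
    have h1 : ∫ u in s..Real.pi, K u ≤ C / (1 + N * s) ^ 5 := by
      have hden : ∀ u ∈ Set.Icc s Real.pi, (1 + N * u) ^ 6 ≠ 0 := fun u hu => by
        have : 0 ≤ u := hs.1.trans hu.1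
        positivity
      calc ∫ u in s..Real.pi, K u ≤ ∫ u in s..Real.pi, C * (N / (1 + N * (u - 0)) ^ (5 + 1)) := by
            apply intervalIntegral.integral_mono_on hs.2 (hKi _ _)
            · apply ContinuousOn.intervalIntegrable
              rw [Set.uIcc_of_le hs.2]
              simp only [sub_zero]
              exact continuousOn_const.mul (continuousOn_const.div (by fun_prop) hden)
            · intro u hu
              rw [sub_zero, ← mul_div_assoc]
              exact hQb u ⟨hs.1.trans hu.1, hu.2⟩
        _ ≤ C * (1 / (1 + N * (s - 0)) ^ 5) := by
            rw [intervalIntegral.integral_const_mul]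
            exact mul_le_mul_of_nonneg_left
              (integral_div_pow_le 5 (by norm_num) hN' hs.1 hs.2) hC.le
        _ = _ := by rw [sub_zero, mul_one_div]
    -- The kernel is even and periodic, hence symmetric about `π`.
    have h2 : ∫ u in Real.pi..(2 * Real.pi - s), K u = ∫ u in s..Real.pi, K u := by
      have := intervalIntegral.integral_comp_sub_left (a := s) (b := Real.pi) K (2 * Real.pi)
      rw [show 2 * Real.pi - Real.pi = Real.pi by ring] at this
      rw [← this]
      congr 1
      ext u
      simp only [hK, Real.cos_two_pi_sub]
    rw [← intervalIntegral.integral_add_adjacent_intervals (hKi s Real.pi) (hKi _ _), h2]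
    calc _ ≤ C / (1 + N * s) ^ 5 + C / (1 + N * s) ^ 5 := add_le_add h1 h1
      _ = _ := by ring
  have hmono : ∀ a b c d, c ≤ a → a ≤ b → b ≤ d → ∫ s in a..b, K s ≤ ∫ s in c..d, K s :=
    fun a b c d h1 h2 h3 => intervalIntegral.integral_mono_interval h1 h2 h3
      (Filter.Eventually.of_forall fun s => hQ0 s) (hKi _ _)
  refine ⟨T, hTd, ?_, fun θ => ?_, fun θ => ?_, fun t ht θ hθ => ⟨?_, ?_, fun h => ?_, fun h => ?_⟩⟩
  · have e : (fun p : ℝ × ℝ => (T p.1).eval (Real.cos p.2)) = fun p =>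
        (∫ s in (0 : ℝ)..(p.2 + p.1), K s) - ∫ s in (0 : ℝ)..(p.2 - p.1), K s := by
      ext p
      rw [hT, intervalIntegral.integral_interval_sub_left (hKi _ _) (hKi _ _)]
    have hP : Continuous fun b => ∫ s in (0 : ℝ)..b, K s :=
      intervalIntegral.continuous_primitive (fun a b => hKi a b) 0
    rw [e]
    exact (hP.comp (continuous_snd.add continuous_fst)).sub
      (hP.comp (continuous_snd.sub continuous_fst))
  · rw [hT, sub_zero, add_zero, intervalIntegral.integral_same]
  · rw [hT, ← hfull (θ - Real.pi)]
    congr 1; ring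
  · rw [hT]
    exact intervalIntegral.integral_nonneg (by linarith [ht.1]) fun s _ => hQ0 s
  · rw [hT, ← hfull (θ - t)]
    exact hmono _ _ _ _ le_rfl (by linarith [ht.1]) (by linarith [ht.2])
  · rw [hT]
    exact (hmono _ _ _ (2 * Real.pi - (θ - t)) le_rfl (by linarith [ht.1])
      (by linarith [hθ.2])).trans (htail _ ⟨by linarith, by linarith [ht.1, hθ.2]⟩)
  -- The total mass over a period is one, so the defect is the mass of the complementary arc, which
  -- stays at distance at least `t - θ` from the multiples of `2π`.
  · have e : 1 - ∫ s in (θ - t)..(θ + t), K s = ∫ s in (θ + t)..(θ - t + 2 * Real.pi), K s := by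
      have h1 := intervalIntegral.integral_interval_sub_left (hKi (θ - t) (θ - t + 2 * Real.pi))
        (hKi (θ - t) (θ + t))
      rwa [hfull] at h1
    rw [hT, e]
    exact (hmono (θ + t) (θ - t + 2 * Real.pi) (t - θ) (2 * Real.pi - (t - θ))
      (by linarith [hθ.1]) (by linarith [ht.2]) (by linarith)).trans
      (htail (t - θ) ⟨by linarith, by linarith [ht.2, hθ.1]⟩)

/-! ### Polynomials close to truncated lines -/

open Polynomial in
lemma exists_antiderivative (P : ℝ[X]) :
    ∃ R : ℝ[X], R.natDegree ≤ P.natDegree + 1 ∧ derivative R = P ∧ R.eval (-1) = 0 := by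
  set S : ℝ[X] := ∑ k ∈ Finset.range (P.natDegree + 1), C (P.coeff k / (k + 1)) * X ^ (k + 1)
  have hS : S.natDegree ≤ P.natDegree + 1 := by
    apply natDegree_sum_le_of_forall_le
    intro k hk
    have := Finset.mem_range.1 hk
    exact (natDegree_C_mul_X_pow_le _ _).trans (by omega)
  refine ⟨S - C (S.eval (-1)), ?_, ?_, by simp⟩
  · exact (natDegree_sub_le _ _).trans (max_le hS (by simp))
  · rw [derivative_sub, derivative_C, sub_zero]
    conv_rhs => rw [P.as_sum_range_C_mul_X_pow]
    rw [derivative_sum]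
    refine Finset.sum_congr rfl fun k _ => ?_
    rw [derivative_C_mul_X_pow]
    have : (k : ℝ) + 1 ≠ 0 := by positivity
    push_cast
    rw [div_mul_cancel₀ _ this]

lemma integral_div_pow_le' {N a b c : ℝ} (k : ℕ) (hk : 1 ≤ k) (hN : 0 ≤ N) (hbc : b ≤ c)
    (hab : a ≤ b) :
    ∫ u in a..b, N / (1 + N * (c - u)) ^ (k + 1) ≤ 1 / (1 + N * (c - b)) ^ k := by
  have h := integral_div_pow_le (a := -b) (b := -a) (c := -c) k hk hN (by linarith) (by linarith)
  have e := intervalIntegral.integral_comp_neg (a := a) (b := b)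
    (fun u => N / (1 + N * (u - -c)) ^ (k + 1))
  rw [← e] at h
  have e1 : ∀ u, -u - -c = c - u := fun u => by ring
  simpa only [e1] using h

open Polynomial in
/-- Polynomial approximation of truncated linear functions. -/
lemma exists_approx_posPart : ∃ C : ℝ, 0 < C ∧ ∀ N : ℕ, 1 ≤ N → ∀ z ∈ Set.Icc (-1 : ℝ) 1,
    ∃ R : ℝ[X], R.natDegree ≤ 3 * (N - 1) + 1 ∧ ∃ t ∈ Set.Icc 0 Real.pi,
      |z - Real.cos t| ≤ C * (Real.sin t + 1 / N) / N ∧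
      ∀ θ ∈ Set.Icc 0 Real.pi, |R.eval (Real.cos θ) - max (Real.cos θ - z) 0| ≤
        C * (Real.sin t + 1 / N) / N / (1 + N * |θ - t|) ^ 3 := by
  obtain ⟨C, hC, hcut⟩ := exists_smooth_cutoff
  refine ⟨C, hC, fun N hN z hz => ?_⟩
  obtain ⟨T, hTd, hTc, hT0, hTpi, hTb⟩ := hcut N hN
  have hN0 : (0 : ℝ) < N := by exact_mod_cast hN
  have hpi := Real.pi_pos
  -- The cutoff `t` is tuned by the intermediate value theorem so that the antiderivative `R`
  -- vanishing at `-1` takes the exact value `1 - z` at `1`. The integral runs from `0` at `t = 0`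
  -- to `2` at `t = π`.
  obtain ⟨t, ht, htz⟩ : ∃ t ∈ Set.Icc 0 Real.pi,
      ∫ τ in (0 : ℝ)..Real.pi, (T t).eval (Real.cos τ) * Real.sin τ = 1 - z := by
    have hc : Continuous fun t => ∫ τ in (0 : ℝ)..Real.pi, (T t).eval (Real.cos τ) * Real.sin τ := by
      apply intervalIntegral.continuous_parametric_intervalIntegral_of_continuous'
      exact hTc.mul (Real.continuous_sin.comp continuous_snd)
    have := intermediate_value_Icc hpi.le hc.continuousOn
    simp only [hT0, hTpi] at this
    refine this ⟨?_, ?_⟩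
    · simp; linarith [hz.2]
    · simp; linarith [hz.1]
  obtain ⟨R, hRd, hR', hR0⟩ := exists_antiderivative (T t)
  refine ⟨R, hRd.trans (by have := hTd t; omega), t, ht, ?_⟩
  have hTt : Continuous fun τ => (T t).eval (Real.cos τ) := by fun_prop
  have hTs : Continuous fun τ => (T t).eval (Real.cos τ) * Real.sin τ := by fun_prop
  have hderiv : ∀ τ, HasDerivAt (fun τ => -R.eval (Real.cos τ))
      ((T t).eval (Real.cos τ) * Real.sin τ) τ := fun τ => by
    refine ((R.hasDerivAt (Real.cos τ)).comp τ (Real.hasDerivAt_cos τ)).neg.congr_deriv ?_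
    rw [hR']; ring
  have hG : ∀ a b, ∫ τ in a..b, (T t).eval (Real.cos τ) * Real.sin τ =
      R.eval (Real.cos a) - R.eval (Real.cos b) := fun a b => by
    rw [intervalIntegral.integral_eq_sub_of_hasDerivAt (fun τ _ => hderiv τ)
      (hTs.intervalIntegrable _ _)]
    ring
  have hRz : R.eval 1 = 1 - z := by
    have := hG 0 Real.pi
    rw [htz, Real.cos_pi, hR0, Real.cos_zero] at this
    linarith
  have hRG : ∀ θ, R.eval (Real.cos θ) =
      ∫ τ in θ..Real.pi, (T t).eval (Real.cos τ) * Real.sin τ := fun θ => by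
    rw [hG, Real.cos_pi, hR0, sub_zero]
  -- Thanks to the value at `1`, the deviation from the line is also an integral of a nonnegative
  -- function, now starting at `0`. So `R` lies above both branches of `(x - z)₊`, and its excess is
  -- at most its distance to either branch. It suffices to bound `R` for `θ ≥ t` and this deviation
  -- for `θ ≤ t`.
  have hRH : ∀ θ, R.eval (Real.cos θ) - (Real.cos θ - z) =
      ∫ τ in (0 : ℝ)..θ, (1 - (T t).eval (Real.cos τ)) * Real.sin τ := fun θ => by
    simp_rw [sub_mul, one_mul]
    rw [intervalIntegral.integral_sub (Real.continuous_sin.intervalIntegrable _ _)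
      (hTs.intervalIntegrable _ _), hG, integral_sin, Real.cos_zero, hRz]
    ring
  have hsin : ∀ τ ∈ Set.Icc 0 Real.pi, 0 ≤ Real.sin τ :=
    fun τ hτ => Real.sin_nonneg_of_mem_Icc hτ
  have hst := hsin t ht
  -- Sine is 1-Lipschitz, so moving the weight from `τ` to `t` costs one power of `1 + N |τ - t|`.
  have hsinle : ∀ τ, Real.sin τ ≤ (Real.sin t + 1 / N) * (1 + N * |τ - t|) := by
    intro τ
    have h1 : Real.sin τ - Real.sin t ≤ |τ - t| := by
      have := Real.abs_sin_sub_sin_le τ t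
      exact (le_abs_self _).trans this
    have h2 : 0 ≤ Real.sin t * (N * |τ - t|) := by positivity
    have h3 : 1 / (N : ℝ) * (N * |τ - t|) = |τ - t| := by field_simp
    have h4 : (0 : ℝ) ≤ 1 / N := by positivity
    nlinarith
  set A := Real.sin t + 1 / (N : ℝ) with hA
  have hApos : 0 < A := by positivity
  have hprod : ∀ τ ∈ Set.Icc 0 Real.pi, ∀ v, v ≤ C / (1 + N * |τ - t|) ^ 5 →
      v * Real.sin τ ≤ C * A / N * (N / (1 + N * |τ - t|) ^ (3 + 1)) := by
    intro τ hτ v hv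
    calc v * Real.sin τ ≤ C / (1 + N * |τ - t|) ^ 5 * Real.sin τ := by
          gcongr; exact hsin τ hτ
      _ ≤ C / (1 + N * |τ - t|) ^ 5 * (A * (1 + N * |τ - t|)) := by
          gcongr; exact hsinle τ
      _ = _ := by
          have : (1 + N * |τ - t|) ≠ 0 := by positivity
          field_simp
  have hcont : Continuous fun τ : ℝ => C * A / N * (N / (1 + N * |τ - t|) ^ (3 + 1)) := by
    apply continuous_const.mul
    apply continuous_const.div (by fun_prop)
    intro τ
    positivity
  have hR_nonneg : ∀ θ ∈ Set.Icc 0 Real.pi, 0 ≤ R.eval (Real.cos θ) := fun θ hθ => by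
    rw [hRG]
    refine intervalIntegral.integral_nonneg hθ.2 fun τ hτ => ?_
    have hτ' : τ ∈ Set.Icc 0 Real.pi := ⟨hθ.1.trans hτ.1, hτ.2⟩
    exact mul_nonneg (hTb t ht τ hτ').1 (hsin τ hτ')
  have hH_nonneg : ∀ θ ∈ Set.Icc 0 Real.pi, 0 ≤ R.eval (Real.cos θ) - (Real.cos θ - z) :=
    fun θ hθ => by
    rw [hRH]
    refine intervalIntegral.integral_nonneg hθ.1 fun τ hτ => ?_
    have hτ' : τ ∈ Set.Icc 0 Real.pi := ⟨hτ.1, hτ.2.trans hθ.2⟩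
    exact mul_nonneg (sub_nonneg.2 (hTb t ht τ hτ').2.1) (hsin τ hτ')
  have hR_le : ∀ θ ∈ Set.Icc t Real.pi,
      R.eval (Real.cos θ) ≤ C * A / N / (1 + N * |θ - t|) ^ 3 := by
    intro θ hθ
    have hθ0 : 0 ≤ θ := ht.1.trans hθ.1
    rw [hRG]
    calc _ ≤ ∫ τ in θ..Real.pi, C * A / N * (N / (1 + N * |τ - t|) ^ (3 + 1)) := by
          refine intervalIntegral.integral_mono_on hθ.2 (hTs.intervalIntegrable _ _)
            (hcont.intervalIntegrable _ _) fun τ hτ => ?_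
          have hτ' : τ ∈ Set.Icc 0 Real.pi := ⟨hθ0.trans hτ.1, hτ.2⟩
          have htτ : t ≤ τ := hθ.1.trans hτ.1
          apply hprod τ hτ'
          rw [abs_of_nonneg (by linarith)]
          exact (hTb t ht τ hτ').2.2.1 htτ
      _ = ∫ τ in θ..Real.pi, C * A / N * (N / (1 + N * (τ - t)) ^ (3 + 1)) := by
          apply intervalIntegral.integral_congr
          intro τ hτ
          rw [Set.uIcc_of_le hθ.2] at hτ
          simp only
          rw [abs_of_nonneg (by linarith [hτ.1, hθ.1])]
      _ ≤ C * A / N * (1 / (1 + N * (θ - t)) ^ 3) := by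
          rw [intervalIntegral.integral_const_mul]
          gcongr
          exact integral_div_pow_le 3 (by norm_num) hN0.le hθ.1 hθ.2
      _ = _ := by rw [mul_one_div, abs_of_nonneg (by linarith [hθ.1])]
  have hH_le : ∀ θ ∈ Set.Icc 0 t,
      R.eval (Real.cos θ) - (Real.cos θ - z) ≤ C * A / N / (1 + N * |θ - t|) ^ 3 := by
    intro θ hθ
    rw [hRH]
    calc _ ≤ ∫ τ in (0 : ℝ)..θ, C * A / N * (N / (1 + N * |τ - t|) ^ (3 + 1)) := by
          refine intervalIntegral.integral_mono_on hθ.1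
            (Continuous.intervalIntegrable (by fun_prop) _ _)
            (hcont.intervalIntegrable _ _) fun τ hτ => ?_
          have hτ' : τ ∈ Set.Icc 0 Real.pi := ⟨hτ.1, hτ.2.trans (hθ.2.trans ht.2)⟩
          have htτ : τ ≤ t := hτ.2.trans hθ.2
          apply hprod τ hτ'
          rw [abs_of_nonpos (by linarith), neg_sub]
          exact (hTb t ht τ hτ').2.2.2 htτ
      _ = ∫ τ in (0 : ℝ)..θ, C * A / N * (N / (1 + N * (t - τ)) ^ (3 + 1)) := by
          apply intervalIntegral.integral_congr
          intro τ hτ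
          rw [Set.uIcc_of_le hθ.1] at hτ
          simp only
          rw [abs_of_nonpos (by linarith [hτ.2, hθ.2]), neg_sub]
      _ ≤ C * A / N * (1 / (1 + N * (t - θ)) ^ 3) := by
          rw [intervalIntegral.integral_const_mul]
          gcongr
          exact integral_div_pow_le' 3 (by norm_num) hN0.le hθ.2 hθ.1
      _ = _ := by rw [mul_one_div, abs_of_nonpos (by linarith [hθ.2]), neg_sub]
  constructor
  -- At `θ = t` both bounds apply, and `z - cos t` is the difference of the two nonnegative
  -- quantities.
  · have h1 := hR_le t ⟨le_rfl, ht.2⟩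
    have h2 := hH_le t ⟨ht.1, le_rfl⟩
    have h3 := hR_nonneg t ht
    have h4 := hH_nonneg t ht
    simp only [sub_self, abs_zero, mul_zero, add_zero, one_pow, div_one] at h1 h2
    rw [abs_le]
    constructor <;> linarith
  · intro θ hθ
    have h3 := hR_nonneg θ hθ
    have h4 := hH_nonneg θ hθ
    rw [abs_of_nonneg (sub_nonneg.2 (max_le (by linarith) h3))]
    rcases le_total t θ with h | h
    · have := hR_le θ ⟨h, hθ.2⟩
      linarith [le_max_right (Real.cos θ - z) 0]
    · have := hH_le θ ⟨hθ.1, h⟩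
      linarith [le_max_left (Real.cos θ - z) 0]

/-! ### Increments of the cosine, and centring the estimate at the knot -/

lemma sin_le_two_mul_sin_midpoint {a b : ℝ} (ha : a ∈ Set.Icc 0 Real.pi)
    (hb : b ∈ Set.Icc 0 Real.pi) :
    Real.sin a + Real.sin b ≤ 2 * Real.sin ((a + b) / 2) := by
  have h : Real.sin a + Real.sin b = 2 * Real.sin ((a + b) / 2) * Real.cos ((a - b) / 2) := by
    have e := (Real.sin_add ((a + b) / 2) ((a - b) / 2)).symm
    have e' := (Real.sin_sub ((a + b) / 2) ((a - b) / 2)).symm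
    rw [show (a + b) / 2 + (a - b) / 2 = a by ring] at e
    rw [show (a + b) / 2 - (a - b) / 2 = b by ring] at e'
    rw [← e, ← e']
    ring
  rw [h]
  have : 0 ≤ Real.sin ((a + b) / 2) :=
    Real.sin_nonneg_of_mem_Icc ⟨by linarith [ha.1, hb.1], by linarith [ha.2, hb.2]⟩
  exact mul_le_of_le_one_right (by positivity) (Real.cos_le_one _)

lemma cos_sub_cos_eq (a b : ℝ) :
    Real.cos a - Real.cos b = 2 * Real.sin ((a + b) / 2) * Real.sin ((b - a) / 2) := by
  rw [Real.cos_sub_cos, show (a - b) / 2 = -((b - a) / 2) by ring, Real.sin_neg]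
  ring

/-- Lower bound for increments of the cosine. -/
lemma sin_mul_le_cos_sub_cos {a b : ℝ} (ha : 0 ≤ a) (hab : a ≤ b) (hb : b ≤ Real.pi) :
    (Real.sin a + Real.sin b) * ((b - a) / Real.pi) ≤ Real.cos a - Real.cos b := by
  have hpi := Real.pi_pos
  have h1 := sin_le_two_mul_sin_midpoint (a := a) (b := b) ⟨ha, by linarith⟩ ⟨by linarith, hb⟩
  have h2 : 2 / Real.pi * ((b - a) / 2) ≤ Real.sin ((b - a) / 2) :=
    Real.mul_le_sin (by linarith) (by linarith)
  have h3 : 2 / Real.pi * ((b - a) / 2) = (b - a) / Real.pi := by field_simp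
  have h4 : 0 ≤ (b - a) / Real.pi := div_nonneg (by linarith) hpi.le
  have h5 : 0 ≤ Real.sin ((a + b) / 2) :=
    Real.sin_nonneg_of_mem_Icc ⟨by linarith, by linarith⟩
  rw [cos_sub_cos_eq]
  calc _ ≤ 2 * Real.sin ((a + b) / 2) * ((b - a) / Real.pi) := by gcongr
    _ ≤ _ := by gcongr; linarith

lemma cos_sub_cos_le_of_le_pi_div_two {a b : ℝ} (ha : 0 ≤ a) (hab : a ≤ b)
    (hb : b ≤ Real.pi / 2) : Real.cos a - Real.cos b ≤ Real.sin b * (b - a) := by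
  rw [cos_sub_cos_eq]
  have h1 : Real.sin ((a + b) / 2) ≤ Real.sin b :=
    Real.sin_le_sin_of_le_of_le_pi_div_two (by linarith) hb (by linarith)
  have h2 : Real.sin ((b - a) / 2) ≤ (b - a) / 2 := Real.sin_le (by linarith)
  have h3 : 0 ≤ Real.sin b := Real.sin_nonneg_of_mem_Icc ⟨by linarith, by linarith [Real.pi_pos]⟩
  have h4 : 0 ≤ Real.sin ((b - a) / 2) :=
    Real.sin_nonneg_of_mem_Icc ⟨by linarith, by linarith [Real.pi_pos]⟩
  calc _ ≤ 2 * Real.sin b * ((b - a) / 2) := by gcongr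
    _ = _ := by ring

/-- The smaller one of two adjacent increments of the cosine is at most `sin ψ` times the mesh. -/
lemma min_cos_sub_cos_le {a ψ b δ : ℝ} (ha : 0 ≤ a) (h1 : a ≤ ψ) (h2 : ψ ≤ b) (hb : b ≤ Real.pi)
    (hδ1 : ψ - a ≤ δ) (hδ2 : b - ψ ≤ δ) :
    min (Real.cos a - Real.cos ψ) (Real.cos ψ - Real.cos b) ≤ Real.sin ψ * δ := by
  have hs : 0 ≤ Real.sin ψ := Real.sin_nonneg_of_mem_Icc ⟨by linarith, by linarith⟩
  -- The increment towards the nearer end of `[0, π]` is used, since sine stays below `sin ψ` on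
  -- that side.
  rcases le_total ψ (Real.pi / 2) with h | h
  · refine (min_le_left _ _).trans ((cos_sub_cos_le_of_le_pi_div_two ha h1 h).trans ?_)
    gcongr
  · refine (min_le_right _ _).trans ?_
    have := cos_sub_cos_le_of_le_pi_div_two (a := Real.pi - b) (b := Real.pi - ψ) (by linarith)
      (by linarith) (by linarith)
    rw [Real.cos_pi_sub, Real.cos_pi_sub, Real.sin_pi_sub] at this
    calc _ ≤ Real.sin ψ * (Real.pi - ψ - (Real.pi - b)) := by linarith
      _ ≤ _ := by gcongr; linarith

-- The auxiliary angle `t` is traded for the angle `θ₀` of the knot. The bound on `|cos θ₀ - cos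
-- t|`, against the lower bound for cosine increments, forces `|θ₀ - t| = O(1/N)`. The condition
-- `sin θ₀ ≥ 1 / (6 N)` keeps the knot away from the end points and lets `sin θ₀` absorb the terms
-- `1 / N`.
open Polynomial in
lemma exists_approx_posPart_cos : ∃ C : ℝ, 0 < C ∧ ∀ N : ℕ, 1 ≤ N → ∀ θ₀ ∈ Set.Icc 0 Real.pi,
    1 / (6 * N) ≤ Real.sin θ₀ → ∃ R : ℝ[X], R.natDegree ≤ 3 * (N - 1) + 1 ∧
      ∀ θ ∈ Set.Icc 0 Real.pi, |R.eval (Real.cos θ) - max (Real.cos θ - Real.cos θ₀) 0| ≤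
        C * Real.sin θ₀ / N / (1 + N * |θ - θ₀|) ^ 2 := by
  obtain ⟨C, hC, H⟩ := exists_approx_posPart
  refine ⟨C * (7 + 168 * C) * (1 + 28 * C) ^ 2, by positivity, fun N hN θ₀ hθ₀ hs => ?_⟩
  obtain ⟨R, hRd, t, ht, hzt, hR⟩ := H N hN (Real.cos θ₀) ⟨Real.neg_one_le_cos _, Real.cos_le_one _⟩
  refine ⟨R, hRd, fun θ hθ => (hR θ hθ).trans ?_⟩
  have hN0 : (0 : ℝ) < N := by exact_mod_cast hN
  have hpi := Real.pi_pos
  have hpi4 := Real.pi_le_four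
  have hs0 : 0 < Real.sin θ₀ := lt_of_lt_of_le (by positivity) hs
  have hst : 0 ≤ Real.sin t := Real.sin_nonneg_of_mem_Icc ht
  have hNs : 1 / (N : ℝ) ≤ 6 * Real.sin θ₀ := by
    have : 1 / (N : ℝ) = 6 * (1 / (6 * N)) := by field_simp
    linarith
  have hcos : (Real.sin θ₀ + Real.sin t) * (|θ₀ - t| / 4) ≤ |Real.cos θ₀ - Real.cos t| := by
    have hq : |θ₀ - t| / 4 ≤ |θ₀ - t| / Real.pi := by gcongr
    refine (mul_le_mul_of_nonneg_left hq (by positivity)).trans ?_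
    rcases le_total θ₀ t with h | h
    · rw [abs_of_nonpos (by linarith), neg_sub]
      exact (sin_mul_le_cos_sub_cos hθ₀.1 h ht.2).trans (le_abs_self _)
    · rw [abs_of_nonneg (by linarith), abs_sub_comm, add_comm]
      exact (sin_mul_le_cos_sub_cos ht.1 h hθ₀.2).trans (le_abs_self _)
  -- The `7` comes from `sin t + 1/N ≤ sin t + 6 sin θ₀`, and `28 = 4 * 7` because `π` was replaced
  -- by `4` in `hcos`.
  have hD : |θ₀ - t| ≤ 28 * C / N := by
    have h1 : (Real.sin θ₀ + Real.sin t) * (|θ₀ - t| / 4) ≤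
        (Real.sin θ₀ + Real.sin t) * (7 * C / N) := by
      refine hcos.trans (hzt.trans ?_)
      calc C * (Real.sin t + 1 / N) / N ≤ C * (7 * (Real.sin θ₀ + Real.sin t)) / N := by
            gcongr; linarith
        _ = _ := by ring
    have h2 := le_of_mul_le_mul_left h1 (by positivity)
    have h3 : 28 * C / N = 4 * (7 * C / N) := by ring
    linarith
  have hsin : Real.sin t + 1 / N ≤ (7 + 168 * C) * Real.sin θ₀ := by
    have h1 := (le_abs_self _).trans (Real.abs_sin_sub_sin_le t θ₀)
    rw [abs_sub_comm] at h1
    have h2 : 28 * C / N ≤ 28 * C * (6 * Real.sin θ₀) := by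
      rw [div_eq_mul_one_div]; gcongr
    linarith
  have hbase : 1 + N * |θ - θ₀| ≤ (1 + 28 * C) * (1 + N * |θ - t|) := by
    have h1 : |θ - θ₀| ≤ |θ - t| + 28 * C / N := by
      have := abs_sub_le θ t θ₀
      rw [abs_sub_comm t θ₀] at this
      linarith
    have h2 : N * |θ - θ₀| ≤ N * |θ - t| + 28 * C := by
      calc _ ≤ N * (|θ - t| + 28 * C / N) := by gcongr
        _ = _ := by field_simp
    have h3 : 0 ≤ 28 * C * (N * |θ - t|) := by positivity
    linarith
  have hone : (1 : ℝ) ≤ 1 + N * |θ - t| := by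
    have : 0 ≤ N * |θ - t| := by positivity
    linarith
  calc C * (Real.sin t + 1 / N) / N / (1 + N * |θ - t|) ^ 3
      ≤ C * ((7 + 168 * C) * Real.sin θ₀) / N / (1 + N * |θ - t|) ^ 2 := by
        gcongr
        norm_num
    _ = C * (7 + 168 * C) * (1 + 28 * C) ^ 2 * Real.sin θ₀ / N /
          ((1 + 28 * C) * (1 + N * |θ - t|)) ^ 2 := by
        have : (1 + N * |θ - t|) ≠ 0 := by positivity
        field_simp
    _ ≤ _ := by gcongr

/-! ### Inverse square sums and piecewise linear interpolation -/

/-- Comparison with a telescoping sum: `u / (1 + |u|)` is a primitive of the summand with values in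
`[-1, 1]`, and each term is at most four times its increment. -/
lemma sum_one_div_one_add_abs_sub_sq_le (y : ℝ) (n : ℕ) :
    ∑ k ∈ Finset.range n, 1 / (1 + |y - k|) ^ 2 ≤ 8 := by
  set g : ℝ → ℝ := fun u => u / (1 + |u|) with hg
  have hstep : ∀ u : ℝ, 1 / (1 + |u|) ^ 2 ≤ 4 * (g (u + 1) - g u) := by
    intro u
    simp only [hg]
    rcases le_total 0 u with h | h
    · rw [abs_of_nonneg h, abs_of_nonneg (by linarith)]
      rw [div_sub_div _ _ (by positivity) (by positivity), mul_div_assoc',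
        div_le_div_iff₀ (by positivity) (by positivity)]
      nlinarith [mul_nonneg h h, mul_nonneg h (mul_nonneg h h)]
    · rcases le_total u (-1) with h' | h'
      · rw [abs_of_nonpos h, abs_of_nonpos (by linarith)]
        have h1 : 0 < 1 + -(u + 1) := by linarith
        have h2 : 0 < 1 + -u := by linarith
        rw [div_sub_div _ _ h1.ne' h2.ne', mul_div_assoc',
          div_le_div_iff₀ (by positivity) (by positivity)]
        obtain ⟨v, rfl⟩ : ∃ v, u = -v := ⟨-u, by ring⟩
        nlinarith [mul_nonneg h2.le h2.le, mul_nonneg (mul_nonneg h2.le h2.le) h1.le]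
      · rw [abs_of_nonpos h, abs_of_nonneg (by linarith)]
        have h2 : 0 < 1 + -u := by linarith
        have e1 : (u + 1) / 2 ≤ (u + 1) / (1 + (u + 1)) :=
          div_le_div_of_nonneg_left (by linarith) (by linarith) (by linarith)
        have e2 : -u / 2 ≤ -u / (1 + -u) :=
          div_le_div_of_nonneg_left (by linarith) (by linarith) (by linarith)
        rw [neg_div] at e2
        rw [neg_div (1 + -u) u] at e2
        have e3 : 1 / (1 + -u) ^ 2 ≤ 1 := by
          rw [div_le_one (by positivity)]
          nlinarith
        linarith
  have hbd : ∀ u, |g u| ≤ 1 := fun u => by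
    simp only [hg]
    rw [abs_div, abs_of_pos (by positivity : 0 < 1 + |u|), div_le_one (by positivity)]
    linarith
  calc _ ≤ ∑ k ∈ Finset.range n, 4 * (g ((k + 1 : ℕ) - y) - g (k - y)) := by
        refine Finset.sum_le_sum fun k _ => ?_
        rw [abs_sub_comm]
        refine (hstep _).trans_eq ?_
        rw [show (k : ℝ) - y + 1 = ((k + 1 : ℕ) : ℝ) - y by push_cast; ring]
    _ = 4 * (g (n - y) - g ((0 : ℕ) - y)) := by
        rw [← Finset.mul_sum, Finset.sum_range_sub (fun k : ℕ => g (k - y))]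
    _ ≤ 8 := by
        have h1 := (abs_le.1 (hbd (n - y))).2
        have h2 := (abs_le.1 (hbd ((0 : ℕ) - y))).1
        linarith

/-- A continuous function vanishing at the end points of an interval is bounded by its symmetric
second differences. -/
lemma abs_le_of_secondDifference_le {a b W : ℝ} {g : ℝ → ℝ} (hg : ContinuousOn g (Set.Icc a b))
    (ha : g a = 0) (hb : g b = 0)
    (hW : ∀ x ∈ Set.Icc a b,
      |g (x + min (x - a) (b - x)) - 2 * g x + g (x - min (x - a) (b - x))| ≤ W)
    {x : ℝ} (hx : x ∈ Set.Icc a b) : |g x| ≤ W := by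
  obtain ⟨u, hu, hmax⟩ := isCompact_Icc.exists_isMaxOn ⟨x, hx⟩ hg.abs
  have hmax' : ∀ v ∈ Set.Icc a b, |g v| ≤ |g u| := fun v hv => hmax hv
  refine (hmax' x hx).trans ?_
  have h := hW u hu
  have hu1 := hu.1
  have hu2 := hu.2
  -- At a maximum `u` of `|g|`, the largest symmetric step reaches an end point, where `g` vanishes.
  -- Only one further value `v` is left, and it cannot exceed `|g u|`.
  have key : ∀ v, |v - 2 * g u| ≤ W → |v| ≤ |g u| → |g u| ≤ W := by
    intro v h1 h2
    have h3 : |2 * g u| = 2 * |g u| := by rw [abs_mul, abs_two]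
    have h4 := abs_sub_abs_le_abs_sub (2 * g u) v
    rw [abs_sub_comm] at h4
    linarith
  rcases le_total (u - a) (b - u) with hle | hle
  · rw [min_eq_left hle, sub_sub_cancel, ha, add_zero] at h
    exact key _ h (hmax' _ ⟨by linarith, by linarith⟩)
  · rw [min_eq_right hle, add_sub_cancel, hb, zero_sub, neg_add_eq_sub] at h
    exact key _ h (hmax' _ ⟨by linarith, by linarith⟩)

/-- The error of linear interpolation. -/
lemma abs_sub_linear_interpolant_le {a b W : ℝ} (hab : a < b) {f : ℝ → ℝ}
    (hf : ContinuousOn f (Set.Icc a b))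
    (hW : ∀ x ∈ Set.Icc a b,
      |f (x + min (x - a) (b - x)) - 2 * f x + f (x - min (x - a) (b - x))| ≤ W)
    {x : ℝ} (hx : x ∈ Set.Icc a b) :
    |f x - (f a + (f b - f a) / (b - a) * (x - a))| ≤ W := by
  have hne : b - a ≠ 0 := (sub_pos.2 hab).ne'
  refine abs_le_of_secondDifference_le (g := fun x => f x - (f a + (f b - f a) / (b - a) * (x - a)))
    (hf.sub (by fun_prop)) (by simp) (by field_simp; ring) (fun y hy => ?_) hx
  convert hW y hy using 2
  ring

/-- The jump of the slope of the piecewise linear interpolant at a node. -/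
lemma abs_slope_sub_slope_le {p q r W : ℝ} (hpq : p < q) (hqr : q < r) {f : ℝ → ℝ}
    (h1 : ∀ x ∈ Set.Icc p q, |f x - (f p + (f q - f p) / (q - p) * (x - p))| ≤ W)
    (h2 : ∀ x ∈ Set.Icc q r, |f x - (f q + (f r - f q) / (r - q) * (x - q))| ≤ W)
    (hq : |f (q + min (q - p) (r - q)) - 2 * f q + f (q - min (q - p) (r - q))| ≤ W) :
    |(f r - f q) / (r - q) - (f q - f p) / (q - p)| ≤ 2 * W / min (q - p) (r - q) := by
  have hp0 := sub_pos.2 hpq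
  have hr0 := sub_pos.2 hqr
  set s₁ := (f q - f p) / (q - p) with hs1
  set s₂ := (f r - f q) / (r - q) with hs2
  have e1 : s₁ * (q - p) = f q - f p := div_mul_cancel₀ _ hp0.ne'
  have e2 : s₂ * (r - q) = f r - f q := div_mul_cancel₀ _ hr0.ne'
  rw [le_div_iff₀ (lt_min hp0 hr0)]
  -- With the shorter gap as step, one neighbour of `q` is a node and the other lies within `W` of
  -- its chord. So the jump times the gap is a second difference up to one interpolation error.
  rcases le_total (q - p) (r - q) with hle | hle
  · rw [min_eq_left hle] at hq ⊢
    have h := h2 (q + (q - p)) ⟨by linarith, by linarith⟩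
    suffices h' : |(s₂ - s₁) * (q - p)| ≤ 2 * W by rwa [abs_mul, abs_of_pos hp0] at h'
    rw [sub_sub_cancel] at hq
    rw [abs_le] at hq h ⊢
    constructor <;> nlinarith
  · rw [min_eq_right hle] at hq ⊢
    have h := h1 (q - (r - q)) ⟨by linarith, by linarith⟩
    suffices h' : |(s₂ - s₁) * (r - q)| ≤ 2 * W by rwa [abs_mul, abs_of_pos hr0] at h'
    rw [add_sub_cancel] at hq
    rw [abs_le] at hq h ⊢
    constructor <;> nlinarith

lemma sum_mul_sub_succ (s E : ℕ → ℝ) (n : ℕ) :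
    ∑ k ∈ Finset.range (n + 1), s k * (E k - E (k + 1)) =
      s 0 * E 0 - s n * E (n + 1) + ∑ k ∈ Finset.range n, (s (k + 1) - s k) * E (k + 1) := by
  induction n with
  | zero => simp; ring
  | succ n ih => rw [Finset.sum_range_succ, ih, Finset.sum_range_succ]; ring

/-- The piecewise linear interpolant in terms of truncated linear functions. -/
lemma piecewise_linear_eq_sum {y : ℕ → ℝ} {n : ℕ} (hy : ∀ j k, j ≤ k → k ≤ n → y j ≤ y k)
    (F : ℕ → ℝ) (s : ℕ → ℝ) (hs : ∀ k < n, s k * (y (k + 1) - y k) = F (k + 1) - F k)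
    {i : ℕ} (hi : i < n) {x : ℝ} (hx : x ∈ Set.Icc (y i) (y (i + 1))) :
    F 0 + ∑ k ∈ Finset.range n, s k * (max (x - y k) 0 - max (x - y (k + 1)) 0) =
      F i + s i * (x - y i) := by
  obtain ⟨d, rfl⟩ : ∃ d, n = i + 1 + d := ⟨n - (i + 1), by omega⟩
  rw [Finset.sum_range_add, Finset.sum_range_succ]
  have h1 : ∑ k ∈ Finset.range i, s k * (max (x - y k) 0 - max (x - y (k + 1)) 0) = F i - F 0 := by
    rw [← Finset.sum_range_sub]
    refine Finset.sum_congr rfl fun k hk => ?_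
    have hk := Finset.mem_range.1 hk
    have a1 : y k ≤ y i := hy _ _ hk.le (by omega)
    have a2 : y (k + 1) ≤ y i := hy _ _ hk (by omega)
    rw [max_eq_left (by linarith [hx.1]), max_eq_left (by linarith [hx.1]), ← hs k (by omega)]
    ring
  have h2 : ∑ k ∈ Finset.range d, s (i + 1 + k) *
      (max (x - y (i + 1 + k)) 0 - max (x - y (i + 1 + k + 1)) 0) = 0 := by
    refine Finset.sum_eq_zero fun k hk => ?_
    have hk := Finset.mem_range.1 hk
    have a1 : y (i + 1) ≤ y (i + 1 + k) := hy _ _ (by omega) (by omega)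
    have a2 : y (i + 1) ≤ y (i + 1 + k + 1) := hy _ _ (by omega) (by omega)
    rw [max_eq_right (by linarith [hx.2]), max_eq_right (by linarith [hx.2])]
    ring
  rw [h1, h2, max_eq_left (by linarith [hx.1]), max_eq_right (by linarith [hx.2])]
  ring

/-! ### Second differences with weight `φ` and the Chebyshev nodes -/

/-- All second differences of `f` with steps at most `φ(x) / m` that stay in `[-1, 1]` are bounded
by `W`. -/
def SecondDifferencesLE (m : ℕ) (f : ℝ → ℝ) (W : ℝ) : Prop :=
  ∀ x η : ℝ, 0 ≤ η → η ≤ phi x / m → -1 ≤ x - η → x + η ≤ 1 →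
    |f (x + η) - 2 * f x + f (x - η)| ≤ W

lemma phi_neg_cos {ψ : ℝ} (h : ψ ∈ Set.Icc 0 Real.pi) : phi (-Real.cos ψ) = Real.sin ψ := by
  have h1 : 1 - (-Real.cos ψ) ^ 2 = Real.sin ψ ^ 2 := by
    have := Real.sin_sq_add_cos_sq ψ
    linarith
  rw [phi, h1, Real.sqrt_sq (Real.sin_nonneg_of_mem_Icc h)]

/-- The second difference at `-cos ψ` with the largest step staying between the nodes `-cos a` and
`-cos b`. -/
lemma SecondDifferencesLE.abs_le {m : ℕ} {f : ℝ → ℝ} {W : ℝ} (hf : SecondDifferencesLE m f W)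
    {a ψ b : ℝ} (ha : 0 ≤ a) (h1 : a ≤ ψ) (h2 : ψ ≤ b) (hb : b ≤ Real.pi)
    (hδ1 : ψ - a ≤ 1 / m) (hδ2 : b - ψ ≤ 1 / m) :
    |f (-Real.cos ψ + min (-Real.cos ψ - -Real.cos a) (-Real.cos b - -Real.cos ψ))
      - 2 * f (-Real.cos ψ) +
      f (-Real.cos ψ - min (-Real.cos ψ - -Real.cos a) (-Real.cos b - -Real.cos ψ))| ≤ W := by
  have hle := min_cos_sub_cos_le ha h1 h2 hb hδ1 hδ2
  rw [← phi_neg_cos ⟨ha.trans h1, h2.trans hb⟩, mul_one_div] at hle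
  have c1 : Real.cos ψ ≤ Real.cos a := Real.cos_le_cos_of_nonneg_of_le_pi ha (h2.trans hb) h1
  have c2 : Real.cos b ≤ Real.cos ψ := Real.cos_le_cos_of_nonneg_of_le_pi (ha.trans h1) hb h2
  have e1 : -Real.cos ψ - -Real.cos a = Real.cos a - Real.cos ψ := by ring
  have e2 : -Real.cos b - -Real.cos ψ = Real.cos ψ - Real.cos b := by ring
  rw [e1, e2]
  have m1 := min_le_left (Real.cos a - Real.cos ψ) (Real.cos ψ - Real.cos b)
  have m2 := min_le_right (Real.cos a - Real.cos ψ) (Real.cos ψ - Real.cos b)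
  exact hf _ _ (le_min (by linarith) (by linarith)) hle
    (by linarith [Real.cos_le_one a]) (by linarith [Real.neg_one_le_cos b])

/-- Nodes `-cos (kπ/M)`. -/
noncomputable def chebyshevNode (M k : ℕ) : ℝ := -Real.cos (k * Real.pi / M)

section nodes

variable {M : ℕ}

lemma mul_pi_div_mem (hM : 0 < M) {k : ℕ} (hk : k ≤ M) : k * Real.pi / M ∈ Set.Icc 0 Real.pi := by
  have hM' : (0 : ℝ) < M := by exact_mod_cast hM
  have hk' : (k : ℝ) ≤ M := by exact_mod_cast hk
  refine ⟨by positivity, ?_⟩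
  rw [div_le_iff₀ hM', mul_comm Real.pi]
  gcongr

lemma chebyshevNode_zero : chebyshevNode M 0 = -1 := by simp [chebyshevNode]

lemma chebyshevNode_self (hM : 0 < M) : chebyshevNode M M = 1 := by
  have hM' : (0 : ℝ) < M := by exact_mod_cast hM
  rw [chebyshevNode, mul_div_cancel_left₀ _ hM'.ne', Real.cos_pi, neg_neg]

lemma chebyshevNode_mem (k : ℕ) : chebyshevNode M k ∈ Set.Icc (-1 : ℝ) 1 :=
  ⟨neg_le_neg (Real.cos_le_one _), neg_le.1 (Real.neg_one_le_cos _)⟩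

lemma chebyshevNode_lt (hM : 0 < M) {j k : ℕ} (hjk : j < k) (hk : k ≤ M) :
    chebyshevNode M j < chebyshevNode M k := by
  have hM' : (0 : ℝ) < M := by exact_mod_cast hM
  have hjk' : (j : ℝ) < k := by exact_mod_cast hjk
  refine neg_lt_neg (Real.cos_lt_cos_of_nonneg_of_le_pi (mul_pi_div_mem hM (by omega)).1
    (mul_pi_div_mem hM hk).2 ?_)
  have := Real.pi_pos
  gcongr

lemma chebyshevNode_le (hM : 0 < M) {j k : ℕ} (hjk : j ≤ k) (hk : k ≤ M) :
    chebyshevNode M j ≤ chebyshevNode M k := by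
  rcases hjk.eq_or_lt with rfl | h
  · exact le_rfl
  · exact (chebyshevNode_lt hM h hk).le

lemma succ_mul_pi_div_sub (k : ℕ) :
    ((k + 1 : ℕ) : ℝ) * Real.pi / M - k * Real.pi / M = Real.pi / M := by
  push_cast; ring

/-- The reason for taking `4 m` cells: since `π ≤ 4`, the angular mesh is at most `1 / m`, which
makes the steps between neighbouring nodes admissible. -/
lemma pi_div_le {m : ℕ} (hm : 0 < m) : Real.pi / (4 * m : ℕ) ≤ 1 / m := by
  have hm' : (0 : ℝ) < m := by exact_mod_cast hm
  rw [div_le_div_iff₀ (by push_cast; positivity) hm']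
  push_cast
  nlinarith [Real.pi_le_four]

/-- The error of piecewise linear interpolation at the nodes. -/
lemma abs_sub_interpolant_le {m : ℕ} (hM : 0 < M) (hm : Real.pi / M ≤ 1 / m) {f : ℝ → ℝ} {W : ℝ}
    (hc : ContinuousOn f (Set.Icc (-1) 1)) (hf : SecondDifferencesLE m f W) {k : ℕ}
    (hk : k < M) {x : ℝ}
    (hx : x ∈ Set.Icc (chebyshevNode M k) (chebyshevNode M (k + 1))) :
    |f x - (f (chebyshevNode M k) +
      (f (chebyshevNode M (k + 1)) - f (chebyshevNode M k)) /
        (chebyshevNode M (k + 1) - chebyshevNode M k) *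
        (x - chebyshevNode M k))| ≤ W := by
  refine abs_sub_linear_interpolant_le (chebyshevNode_lt hM (Nat.lt_add_one k) hk)
    (hc.mono (Set.Icc_subset_Icc (chebyshevNode_mem k).1 (chebyshevNode_mem (k + 1)).2))
    (fun y hy => ?_) hx
  have hy' : y ∈ Set.Icc (-1 : ℝ) 1 :=
    ⟨(chebyshevNode_mem k).1.trans hy.1, hy.2.trans (chebyshevNode_mem (k + 1)).2⟩
  obtain ⟨ψ, hψ, rfl⟩ : ∃ ψ ∈ Set.Icc 0 Real.pi, y = -Real.cos ψ :=
    ⟨Real.arccos (-y), ⟨Real.arccos_nonneg _, Real.arccos_le_pi _⟩, by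
      rw [Real.cos_arccos (by linarith [hy'.2]) (by linarith [hy'.1]), neg_neg]⟩
  have a1 : k * Real.pi / M ≤ ψ := by
    by_contra h
    push Not at h
    have := Real.cos_lt_cos_of_nonneg_of_le_pi hψ.1 (mul_pi_div_mem hM hk.le).2 h
    have h' := hy.1
    rw [chebyshevNode] at h'
    linarith
  have a2 : ψ ≤ ((k + 1 : ℕ) : ℝ) * Real.pi / M := by
    by_contra h
    push Not at h
    have := Real.cos_lt_cos_of_nonneg_of_le_pi (mul_pi_div_mem hM hk).1 hψ.2 h
    have h' := hy.2
    rw [chebyshevNode] at h'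
    linarith
  have a3 := succ_mul_pi_div_sub (M := M) k
  exact hf.abs_le (mul_pi_div_mem hM hk.le).1 a1 a2 (mul_pi_div_mem hM hk).2
    (by linarith) (by linarith)

/-- The lower bound for a cosine increment contains the sines at both ends; one of them is kept.
This bounds from below the gap by which slope jumps are divided. -/
lemma sin_div_le_node_gap (hM : 0 < M) {k j : ℕ} (hk : k < M) (hj : j = k ∨ j = k + 1) :
    Real.sin (j * Real.pi / M) / M ≤ chebyshevNode M (k + 1) - chebyshevNode M k := by
  have hM' : (0 : ℝ) < M := by exact_mod_cast hM
  have hpi := Real.pi_pos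
  have m0 := mul_pi_div_mem hM hk.le
  have m1 := mul_pi_div_mem hM (Nat.succ_le_of_lt hk)
  have a3 := succ_mul_pi_div_sub (M := M) k
  have a5 : 0 < Real.pi / M := by positivity
  have s0 := Real.sin_nonneg_of_mem_Icc m0
  have s1 := Real.sin_nonneg_of_mem_Icc m1
  have g := sin_mul_le_cos_sub_cos m0.1
    (by linarith : _ ≤ ((k + 1 : ℕ) : ℝ) * Real.pi / M) m1.2
  have e : Real.pi / M / Real.pi = 1 / M := by field_simp
  rw [a3, e, mul_one_div] at g
  rw [chebyshevNode, chebyshevNode, neg_sub_neg]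
  refine le_trans ?_ g
  rcases hj with rfl | rfl
  · gcongr; exact le_add_of_nonneg_right s1
  · gcongr; exact le_add_of_nonneg_left s0

lemma abs_secondDifference_node_le {m : ℕ} (hM : 0 < M) (hm : Real.pi / M ≤ 1 / m) {f : ℝ → ℝ}
    {W : ℝ} (hf : SecondDifferencesLE m f W) {k : ℕ} (hk : k + 1 < M) :
    |f (chebyshevNode M (k + 1) + min (chebyshevNode M (k + 1) - chebyshevNode M k)
        (chebyshevNode M (k + 1 + 1) - chebyshevNode M (k + 1))) -
      2 * f (chebyshevNode M (k + 1)) +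
      f (chebyshevNode M (k + 1) - min (chebyshevNode M (k + 1) - chebyshevNode M k)
        (chebyshevNode M (k + 1 + 1) - chebyshevNode M (k + 1)))| ≤ W := by
  have hM' : (0 : ℝ) < M := by exact_mod_cast hM
  have hpi := Real.pi_pos
  have a3 := succ_mul_pi_div_sub (M := M) k
  have a3' := succ_mul_pi_div_sub (M := M) (k + 1)
  have a5 : 0 < Real.pi / M := by positivity
  have m0 := mul_pi_div_mem hM (by omega : k ≤ M)
  have m2 := mul_pi_div_mem hM (by omega : k + 1 + 1 ≤ M)
  simp only [chebyshevNode]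
  exact hf.abs_le m0.1 (by linarith) (by linarith) m2.2 (by linarith) (by linarith)

/-- The jumps of the slope of the piecewise linear interpolant at the nodes. -/
lemma abs_interpolant_slope_sub_le {m : ℕ} (hM : 0 < M) (hm : Real.pi / M ≤ 1 / m) {f : ℝ → ℝ}
    {W : ℝ} (hW : 0 ≤ W) (hc : ContinuousOn f (Set.Icc (-1) 1)) (hf : SecondDifferencesLE m f W)
    {k : ℕ} (hk : k + 1 < M) :
    |(f (chebyshevNode M (k + 1 + 1)) - f (chebyshevNode M (k + 1))) /
        (chebyshevNode M (k + 1 + 1) - chebyshevNode M (k + 1)) -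
      (f (chebyshevNode M (k + 1)) - f (chebyshevNode M k)) /
        (chebyshevNode M (k + 1) - chebyshevNode M k)| *
      Real.sin ((k + 1 : ℕ) * Real.pi / M) ≤ 2 * W * M := by
  have hM' : (0 : ℝ) < M := by exact_mod_cast hM
  have l1 := chebyshevNode_lt hM (Nat.lt_add_one k) hk.le
  have l2 := chebyshevNode_lt hM (Nat.lt_add_one (k + 1)) hk
  have hk' : k < M := (Nat.lt_add_one k).trans hk
  have hjump := abs_slope_sub_slope_le l1 l2
    (fun x hx => abs_sub_interpolant_le hM hm hc hf hk' hx)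
    (fun x hx => abs_sub_interpolant_le hM hm hc hf hk hx)
    (abs_secondDifference_node_le hM hm hf hk)
  have hlow := le_min (sin_div_le_node_gap hM hk' (Or.inr rfl))
    (sin_div_le_node_gap hM hk (Or.inl rfl))
  have hη0 := lt_min (sub_pos.2 l1) (sub_pos.2 l2)
  rw [div_le_iff₀ hM'] at hlow
  refine (mul_le_mul hjump hlow (Real.sin_nonneg_of_mem_Icc (mul_pi_div_mem hM hk.le))
    (div_nonneg (mul_nonneg zero_le_two hW) hη0.le)).trans_eq ?_
  rw [← mul_assoc, div_mul_cancel₀ _ hη0.ne']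

end nodes

/-! ### The univariate approximation operators -/

/-- Jordan's inequality, with the reflection `k ↦ M - k` for the right half. It shows that interior
nodes are far enough from the end points for centring. -/
lemma two_div_le_sin_node {M k : ℕ} (hk : 0 < k) (hkM : k < M) :
    2 / M ≤ Real.sin (k * Real.pi / M) := by
  have hM' : (0 : ℝ) < M := by exact_mod_cast hk.trans hkM
  have hpi := Real.pi_pos
  have hk1 : (1 : ℝ) ≤ k := by exact_mod_cast hk
  have hk2 : (k : ℝ) + 1 ≤ M := by exact_mod_cast hkM
  have key : ∀ j : ℝ, 1 ≤ j → j * Real.pi / M ≤ Real.pi / 2 → 2 / M ≤ Real.sin (j * Real.pi / M) := by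
    intro j hj h
    refine le_trans ?_ (Real.mul_le_sin (by positivity) h)
    rw [show 2 / Real.pi * (j * Real.pi / M) = 2 * j / M by field_simp]
    gcongr
    linarith
  rcases le_total (k * Real.pi / M) (Real.pi / 2) with h | h
  · exact key k hk1 h
  · have e : (M - k : ℝ) * Real.pi / M = Real.pi - k * Real.pi / M := by field_simp
    have := key (M - k) (by linarith) (by rw [e]; linarith)
    rwa [e, Real.sin_pi_sub] at this

open Polynomial in
/-- Approximation of the truncated linear functions at the nodes, with exact representation at the
end points. -/
lemma exists_approx_posPart_node : ∃ C : ℝ, 0 < C ∧ ∀ m : ℕ, 1 ≤ m → ∃ R : ℕ → ℝ[X],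
    (∀ k, (R k).natDegree ≤ m) ∧
    (∀ x ∈ Set.Icc (-1 : ℝ) 1, max (x - chebyshevNode (4 * m) 0) 0 = (R 0).eval x) ∧
    (∀ x ∈ Set.Icc (-1 : ℝ) 1, max (x - chebyshevNode (4 * m) (4 * m)) 0 = (R (4 * m)).eval x) ∧
    ∀ k, 0 < k → k < 4 * m → ∀ u : ℝ, u * Real.pi / (4 * m : ℕ) ∈ Set.Icc 0 Real.pi →
      |max (-Real.cos (u * Real.pi / (4 * m : ℕ)) - chebyshevNode (4 * m) k) 0 -
        (R k).eval (-Real.cos (u * Real.pi / (4 * m : ℕ)))| ≤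
      C * Real.sin (k * Real.pi / (4 * m : ℕ)) / (4 * m : ℕ) * (1 / (1 + |u - k|) ^ 2) := by
  obtain ⟨C, hC, H⟩ := exists_approx_posPart_cos
  refine ⟨C * 12 * 16, by positivity, fun m hm => ?_⟩
  -- The largest `N` with `3 (N - 1) + 1 ≤ m`; it still satisfies `4 m ≤ 12 N`, the source of the
  -- factor `12`. The factor `16` is the square of the `4` in `hden`.
  set N := (m - 1) / 3 + 1 with hN
  have hN1 : 1 ≤ N := by omega
  have hNm : 3 * (N - 1) + 1 ≤ m := by omega
  have hmN : 4 * m ≤ 12 * N := by omega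
  generalize hM : 4 * m = M at *
  have hM0 : 0 < M := by omega
  have hM' : (0 : ℝ) < M := by exact_mod_cast hM0
  have hN' : (0 : ℝ) < N := by exact_mod_cast hN1
  have hMN : (M : ℝ) ≤ 12 * N := by exact_mod_cast hmN
  have hpi := Real.pi_gt_three
  have main : ∀ k, 0 < k ∧ k < M → ∃ R : ℝ[X], R.natDegree ≤ m ∧
      ∀ u : ℝ, u * Real.pi / M ∈ Set.Icc 0 Real.pi →
      |max (-Real.cos (u * Real.pi / M) - chebyshevNode M k) 0 -
        R.eval (-Real.cos (u * Real.pi / M))| ≤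
      C * 12 * 16 * Real.sin (k * Real.pi / M) / M * (1 / (1 + |u - k|) ^ 2) := by
    rintro k ⟨hk, hkM⟩
    have hkm := mul_pi_div_mem hM0 hkM.le
    have hs := two_div_le_sin_node hk hkM
    -- The reflection `θ ↦ π - θ` converts the nodes `-cos` into the `cos` of the earlier estimate.
    obtain ⟨R, hRd, hR⟩ := H N hN1 (Real.pi - k * Real.pi / M)
      ⟨by linarith [hkm.2], by linarith [hkm.1]⟩ (by
        rw [Real.sin_pi_sub]
        refine le_trans ?_ hs
        rw [div_le_div_iff₀ (by positivity) hM']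
        linarith)
    refine ⟨R, hRd.trans hNm, fun u hu => ?_⟩
    have h := hR (Real.pi - u * Real.pi / M) ⟨by linarith [hu.2], by linarith [hu.1]⟩
    rw [Real.cos_pi_sub, Real.cos_pi_sub, Real.sin_pi_sub, abs_sub_comm] at h
    rw [chebyshevNode]
    refine h.trans ?_
    have e : |Real.pi - u * Real.pi / M - (Real.pi - k * Real.pi / M)| =
        |u - k| * (Real.pi / M) := by
      have e' : Real.pi - u * Real.pi / M - (Real.pi - k * Real.pi / M) =
          -((u - k) * (Real.pi / M)) := by ring
      rw [e', abs_neg, abs_mul, abs_of_pos (by positivity : 0 < Real.pi / (M : ℝ))]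
    have hs0 : 0 ≤ Real.sin (k * Real.pi / M) := Real.sin_nonneg_of_mem_Icc hkm
    have h4 : 1 / 4 ≤ N * (Real.pi / M) := by
      rw [mul_div_assoc', div_le_div_iff₀ (by norm_num) hM']
      nlinarith
    have hden : (1 + |u - k|) / 4 ≤ 1 + N * (|u - k| * (Real.pi / M)) := by
      have : |u - k| * (1 / 4) ≤ |u - k| * (N * (Real.pi / M)) := by gcongr
      linarith [abs_nonneg (u - k)]
    have hN12 : 1 / (N : ℝ) ≤ 12 / M := by
      rw [div_le_div_iff₀ hN' hM']; linarith
    rw [e]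
    calc _ = C * Real.sin (k * Real.pi / M) * (1 / N) /
          (1 + N * (|u - k| * (Real.pi / M))) ^ 2 := by ring
      _ ≤ C * Real.sin (k * Real.pi / M) * (12 / M) / ((1 + |u - k|) / 4) ^ 2 := by gcongr
      _ = _ := by field_simp; norm_num
  choose! R hRd hR using main
  -- On `[-1, 1]` the truncated lines with knots `-1` and `1` are `x + 1` and `0`, which are already
  -- polynomials. Exactness there removes the boundary terms of the summation by parts.
  refine ⟨fun k => if k = 0 then X + 1 else if k < M then R k else 0, fun k => ?_, fun x hx => ?_,
    fun x hx => ?_, fun k hk hkM u hu => ?_⟩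
  · simp only
    split_ifs with h1 h2
    · rw [← C_1, natDegree_X_add_C]; exact hm
    · exact hRd k ⟨by omega, h2⟩
    · simp
  · rw [chebyshevNode_zero, max_eq_left (by linarith [hx.1])]
    simp
  · rw [chebyshevNode_self hM0, max_eq_right (by linarith [hx.2])]
    simp [hM0.ne']
  · simp only [hk.ne', if_false, hkM, if_true]
    exact hR k ⟨hk, hkM⟩ u hu

lemma exists_chebyshevNode_cell {M : ℕ} (hM : 0 < M) {x : ℝ} (hx : x ∈ Set.Icc (-1 : ℝ) 1) :
    ∃ i < M, x ∈ Set.Icc (chebyshevNode M i) (chebyshevNode M (i + 1)) := by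
  by_contra hcon
  push Not at hcon
  have hle : ∀ i ≤ M, chebyshevNode M i ≤ x := by
    intro i
    induction i with
    | zero => intro _; rw [chebyshevNode_zero]; exact hx.1
    | succ i ih =>
      intro h
      by_contra hlt
      exact hcon i h ⟨ih (by omega), (not_le.1 hlt).le⟩
  obtain ⟨n, rfl⟩ : ∃ n, M = n + 1 := ⟨M - 1, by omega⟩
  refine hcon n (by omega) ⟨hle n (by omega), ?_⟩
  rw [chebyshevNode_self hM]
  exact hx.2

/-- Replacing the truncated linear functions in the piecewise linear interpolant by functions
`r k` close to them. -/
lemma abs_sub_sum_slope_mul_le {m n : ℕ} (hm : Real.pi / (n + 1 : ℕ) ≤ 1 / m) {f : ℝ → ℝ}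
    {W c u x : ℝ} (hW : 0 ≤ W) (hc : 0 ≤ c) (hf : ContinuousOn f (Set.Icc (-1) 1))
    (hfW : SecondDifferencesLE m f W) (hx : x ∈ Set.Icc (-1 : ℝ) 1) (r : ℕ → ℝ)
    (hr0 : max (x - chebyshevNode (n + 1) 0) 0 = r 0)
    (hrM : max (x - chebyshevNode (n + 1) (n + 1)) 0 = r (n + 1))
    (hr : ∀ k, 0 < k → k < n + 1 → |max (x - chebyshevNode (n + 1) k) 0 - r k| ≤
      c * Real.sin (k * Real.pi / (n + 1 : ℕ)) / (n + 1 : ℕ) * (1 / (1 + |u - k|) ^ 2)) :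
    |f x - (f (chebyshevNode (n + 1) 0) + ∑ k ∈ Finset.range (n + 1),
      (f (chebyshevNode (n + 1) (k + 1)) - f (chebyshevNode (n + 1) k)) /
        (chebyshevNode (n + 1) (k + 1) - chebyshevNode (n + 1) k) * (r k - r (k + 1)))| ≤
      (1 + 2 * c * 8) * W := by
  have hM0 : 0 < n + 1 := n.succ_pos
  have hM' : (0 : ℝ) < (n + 1 : ℕ) := by exact_mod_cast hM0
  obtain ⟨i, hi, hxi⟩ := exists_chebyshevNode_cell hM0 hx
  have herr := abs_sub_interpolant_le hM0 hm hf hfW hi hxi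
  have hslope : ∀ k < n + 1, chebyshevNode (n + 1) (k + 1) - chebyshevNode (n + 1) k ≠ 0 :=
    fun k hk => (sub_pos.2 (chebyshevNode_lt hM0 (Nat.lt_add_one k) hk)).ne'
  have hjump : ∀ k < n, _ := fun k (hk : k < n) =>
    abs_interpolant_slope_sub_le hM0 hm hW hf hfW (Nat.succ_lt_succ hk)
  have hmono : ∀ j k, j ≤ k → k ≤ n + 1 → chebyshevNode (n + 1) j ≤ chebyshevNode (n + 1) k :=
    fun j k h1 h2 => chebyshevNode_le hM0 h1 h2
  generalize chebyshevNode (n + 1) = y at *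
  set s : ℕ → ℝ := fun k => (f (y (k + 1)) - f (y k)) / (y (k + 1) - y k) with hs
  have hspline := piecewise_linear_eq_sum hmono (fun k => f (y k)) s
    (fun k hk => div_mul_cancel₀ _ (hslope k hk)) hi hxi
  set E : ℕ → ℝ := fun k => max (x - y k) 0 - r k with hE
  have hdecomp : f x - (f (y 0) + ∑ k ∈ Finset.range (n + 1), s k * (r k - r (k + 1))) =
      (f x - (f (y i) + s i * (x - y i))) +
        ∑ k ∈ Finset.range n, (s (k + 1) - s k) * E (k + 1) := by
    have h1 := sum_mul_sub_succ s E n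
    have e0 : E 0 = 0 := sub_eq_zero.2 hr0
    have e1 : E (n + 1) = 0 := sub_eq_zero.2 hrM
    rw [e0, e1, mul_zero, mul_zero, sub_zero, zero_add] at h1
    have h2 : ∑ k ∈ Finset.range (n + 1), s k * (E k - E (k + 1)) =
        ∑ k ∈ Finset.range (n + 1), s k * (max (x - y k) 0 - max (x - y (k + 1)) 0) -
        ∑ k ∈ Finset.range (n + 1), s k * (r k - r (k + 1)) := by
      rw [← Finset.sum_sub_distrib]
      refine Finset.sum_congr rfl fun k _ => ?_
      simp only [hE]; ring
    linarith
  -- The sine and the number of nodes cancel between the slope jump and the truncation error. The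
  -- centre is `u - 1` because the `k`-th term belongs to node `k + 1`.
  have hterm : ∀ k ∈ Finset.range n, |(s (k + 1) - s k) * E (k + 1)| ≤
      2 * W * c * (1 / (1 + |(u - 1) - k|) ^ 2) := by
    intro k hk
    have hk := Finset.mem_range.1 hk
    have hE1 := hr (k + 1) k.succ_pos (Nat.succ_lt_succ hk)
    have hJ := hjump k hk
    have hg : (0 : ℝ) ≤ 1 / (1 + |u - (k + 1 : ℕ)|) ^ 2 := by positivity
    rw [show (u - 1) - k = u - (k + 1 : ℕ) by push_cast; ring, abs_mul]
    set g := 1 / (1 + |u - (k + 1 : ℕ)|) ^ 2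
    calc _ ≤ |s (k + 1) - s k| * (c * Real.sin ((k + 1 : ℕ) * Real.pi / (n + 1 : ℕ)) /
          (n + 1 : ℕ) * g) := mul_le_mul_of_nonneg_left hE1 (abs_nonneg _)
      _ = |s (k + 1) - s k| * Real.sin ((k + 1 : ℕ) * Real.pi / (n + 1 : ℕ)) *
          (c / (n + 1 : ℕ) * g) := by ring
      _ ≤ 2 * W * (n + 1 : ℕ) * (c / (n + 1 : ℕ) * g) :=
          mul_le_mul_of_nonneg_right hJ (mul_nonneg (div_nonneg hc hM'.le) hg)
      _ = _ := by field_simp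
  rw [hdecomp]
  calc _ ≤ |f x - (f (y i) + s i * (x - y i))| +
        ∑ k ∈ Finset.range n, |(s (k + 1) - s k) * E (k + 1)| :=
        (abs_add_le _ _).trans (by gcongr; exact Finset.abs_sum_le_sum_abs _ _)
    _ ≤ W + ∑ k ∈ Finset.range n, 2 * W * c * (1 / (1 + |(u - 1) - k|) ^ 2) :=
        add_le_add herr (Finset.sum_le_sum hterm)
    _ ≤ W + 2 * W * c * 8 := by
        rw [← Finset.mul_sum]
        gcongr
        exact sum_one_div_one_add_abs_sub_sq_le _ _
    _ = _ := by ring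

open Polynomial in
/-- Linear approximation operators with values in the polynomials of degree at most `m`, with error
controlled by the second differences with steps at most `φ(x) / m`. -/
theorem exists_linear_approximation : ∃ c : ℝ, 0 < c ∧ ∀ m : ℕ, 1 ≤ m →
    ∃ (ι : Type) (_ : Fintype ι) (z : ι → ℝ) (B : ι → ℝ[X]),
      (∀ i, z i ∈ Set.Icc (-1 : ℝ) 1) ∧ (∀ i, (B i).natDegree ≤ m) ∧
      ∀ (f : ℝ → ℝ) (W : ℝ), 0 ≤ W → ContinuousOn f (Set.Icc (-1) 1) →
        SecondDifferencesLE m f W → ∀ x ∈ Set.Icc (-1 : ℝ) 1,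
          |f x - ∑ i, f (z i) * (B i).eval x| ≤ c * W := by
  obtain ⟨c, hc, H⟩ := exists_approx_posPart_node
  refine ⟨1 + 2 * c * 8, by positivity, fun m hm => ?_⟩
  obtain ⟨R, hRd, hR0, hRM, hR⟩ := H m hm
  have hMm := pi_div_le hm
  obtain ⟨n, hn⟩ : ∃ n, 4 * m = n + 1 := ⟨4 * m - 1, by omega⟩
  rw [hn] at hR0 hRM hR hMm
  set y := chebyshevNode (n + 1) with hy
  -- One index for the constant term `f (y 0)`, and two copies of the cells for the two values of
  -- `f` in each divided difference.
  refine ⟨Option (Fin (n + 1) ⊕ Fin (n + 1)), inferInstance,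
    fun i => i.elim (y 0) (Sum.elim (fun k => y (k + 1)) fun k => y k),
    fun i => i.elim 1 (Sum.elim
      (fun k => C (1 / (y (k + 1) - y k)) * (R k - R (k + 1)))
      fun k => C (-(1 / (y (k + 1) - y k))) * (R k - R (k + 1))), ?_, ?_, ?_⟩
  · rintro (_ | k | k) <;> exact chebyshevNode_mem _
  · have hd : ∀ (a : ℝ) (k : ℕ), (C a * (R k - R (k + 1))).natDegree ≤ m := fun a k =>
      (natDegree_C_mul_le _ _).trans ((natDegree_sub_le _ _).trans (max_le (hRd _) (hRd _)))
    rintro (_ | k | k)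
    · exact natDegree_one.trans_le m.zero_le
    · exact hd _ _
    · exact hd _ _
  intro f W hW hf hfW x hx
  obtain ⟨u, hu, hxu⟩ : ∃ u : ℝ, u * Real.pi / (n + 1 : ℕ) ∈ Set.Icc 0 Real.pi ∧
      x = -Real.cos (u * Real.pi / (n + 1 : ℕ)) := by
    have e : Real.arccos (-x) * (n + 1 : ℕ) / Real.pi * Real.pi / (n + 1 : ℕ) = Real.arccos (-x) := by
      have : ((n + 1 : ℕ) : ℝ) ≠ 0 := by positivity
      field_simp
    refine ⟨Real.arccos (-x) * (n + 1 : ℕ) / Real.pi, ?_, ?_⟩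
    · rw [e]; exact ⟨Real.arccos_nonneg _, Real.arccos_le_pi _⟩
    · rw [e, Real.cos_arccos (by linarith [hx.2]) (by linarith [hx.1]), neg_neg]
  have hmain := abs_sub_sum_slope_mul_le hMm hW hc.le hf hfW hx (fun k => (R k).eval x)
    (hR0 x hx) (hRM x hx) (u := u) (fun k h1 h2 => by
      have := hR k h1 h2 u hu
      rwa [← hxu] at this)
  rw [Finset.sum_range] at hmain
  convert hmain using 4
  rw [Fintype.sum_option, Fintype.sum_sum_type, ← Finset.sum_add_distrib]
  simp only [Option.elim, Sum.elim_inl, Sum.elim_inr, eval_one, mul_one, eval_mul, eval_C,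
    eval_sub]
  congr 1
  refine Finset.sum_congr rfl fun k _ => ?_
  ring

/-! ### From the bivariate modulus to second differences in one variable -/

lemma phi_nonneg (x : ℝ) : 0 ≤ phi x := Real.sqrt_nonneg _

lemma phi_le_one (x : ℝ) : phi x ≤ 1 := by
  rw [phi]
  exact Real.sqrt_le_iff.2 ⟨zero_le_one, by linarith [sq_nonneg x]⟩

lemma symmDifference_two_of_mem {f : C(Square, ℝ)} {h₁ h₂ : ℝ} {p : Square}
    (hx1 : (p.1 : ℝ) + h₁ * phi p.1 ≤ 1) (hx2 : -1 ≤ (p.1 : ℝ) - h₁ * phi p.1)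
    (hy1 : (p.2 : ℝ) + h₂ * phi p.2 ≤ 1) (hy2 : -1 ≤ (p.2 : ℝ) - h₂ * phi p.2)
    (h1 : 0 ≤ h₁) (h2 : 0 ≤ h₂) :
    symmDifference 2 h₁ h₂ f p =
      f (Set.projIcc (-1 : ℝ) 1 (by norm_num) (p.1 + h₁ * phi p.1),
        Set.projIcc (-1 : ℝ) 1 (by norm_num) (p.2 + h₂ * phi p.2)) -
      2 * f (Set.projIcc (-1 : ℝ) 1 (by norm_num) p.1,
        Set.projIcc (-1 : ℝ) 1 (by norm_num) p.2) +
      f (Set.projIcc (-1 : ℝ) 1 (by norm_num) (p.1 - h₁ * phi p.1),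
        Set.projIcc (-1 : ℝ) 1 (by norm_num) (p.2 - h₂ * phi p.2)) := by
  have a1 := mul_nonneg h1 (phi_nonneg p.1)
  have a2 := mul_nonneg h2 (phi_nonneg p.2)
  have e : ∀ h v : ℝ, ((2 : ℕ) : ℝ) * h * v / 2 = h * v := fun h v => by push_cast; ring
  rw [symmDifference]
  simp only [e]
  rw [if_pos ⟨⟨by linarith, hx1⟩, ⟨hx2, by linarith⟩, ⟨by linarith, hy1⟩, ⟨hy2, by linarith⟩⟩]
  have c0 : ((2 : ℕ) : ℝ) / 2 - ((0 : ℕ) : ℝ) = 1 := by norm_num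
  have c1 : ((2 : ℕ) : ℝ) / 2 - ((1 : ℕ) : ℝ) = 0 := by norm_num
  have c2 : ((2 : ℕ) : ℝ) / 2 - ((2 : ℕ) : ℝ) = -1 := by norm_num
  simp only [Finset.sum_range_succ, Finset.sum_range_zero, c0, c1, c2, mul_one, mul_zero, add_zero,
    mul_neg, ← sub_eq_add_neg]
  norm_num [Nat.choose]
  ring

/-- This bounds the set whose `sSup` is the modulus; for an unbounded set `sSup` would take the
default value zero. -/
lemma abs_symmDifference_two_le (f : C(Square, ℝ)) (h₁ h₂ : ℝ) (p : Square) :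
    |symmDifference 2 h₁ h₂ f p| ≤ 4 * ‖f‖ := by
  rw [symmDifference]
  split_ifs
  · simp only [Finset.sum_range_succ, Finset.sum_range_zero]
    norm_num [Nat.choose]
    refine (abs_add_three _ _ _).trans ?_
    rw [abs_neg, abs_mul, abs_two]
    have := fun q => f.norm_coe_le_norm q
    simp only [Real.norm_eq_abs] at this
    calc _ ≤ ‖f‖ + 2 * ‖f‖ + ‖f‖ := by gcongr <;> exact this _
      _ = _ := by ring
  · simp

lemma abs_symmDifference_le_modulus (f : C(Square, ℝ)) {h₁ h₂ δ₁ δ₂ : ℝ} (p : Square)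
    (h1 : 0 < h₁) (h1' : h₁ ≤ δ₁) (h2 : 0 < h₂) (h2' : h₂ ≤ δ₂) :
    |symmDifference 2 h₁ h₂ f p| ≤ modulus 2 f δ₁ δ₂ := by
  refine le_csSup ⟨4 * ‖f‖, ?_⟩ ⟨h₁, h₂, p, h1, h1', h2, h2', rfl⟩
  rintro _ ⟨h₁, h₂, p, -, -, -, -, rfl⟩
  exact abs_symmDifference_two_le f h₁ h₂ p

lemma modulus_nonneg (f : C(Square, ℝ)) (δ₁ δ₂ : ℝ) : 0 ≤ modulus 2 f δ₁ δ₂ := by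
  apply Real.sSup_nonneg
  rintro _ ⟨h₁, h₂, p, -, -, -, -, rfl⟩
  exact abs_nonneg _

open Filter Topology in
/-- Each admissible step is a limit of positive multiples of `φ(x)`. -/
lemma eventually_exists_step {x a δ : ℝ} (hδ : 0 < δ) (ha : 0 ≤ a) (haδ : a ≤ phi x * δ)
    (hx1 : x + a ≤ 1) (hx2 : -1 ≤ x - a) :
    ∀ᶠ t in 𝓝[>] (0 : ℝ), ∃ h, 0 < h ∧ h ≤ δ ∧ h * phi x = max a (t * phi x) ∧
      x + h * phi x ≤ 1 ∧ -1 ≤ x - h * phi x := by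
  have hφ := phi_nonneg x
  have hφ1 := phi_le_one x
  rcases ha.eq_or_lt with rfl | ha
  · rcases hφ.eq_or_lt with h0 | hpos
    -- Where `φ` vanishes every step gives the zero displacement. In the other cases the step is `t`
    -- if `a = 0`, and `a / φ(x)` if `a > 0`.
    · refine Eventually.of_forall fun t => ⟨δ, hδ, le_rfl, ?_⟩
      rw [← h0]
      simp only [mul_zero, max_self, true_and]
      exact ⟨hx1, hx2⟩
    · have hx : x ^ 2 < 1 := by
        by_contra h
        have : phi x = 0 := Real.sqrt_eq_zero_of_nonpos (by linarith)
        exact hpos.ne' this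
      have hxa := (sq_lt_one_iff_abs_lt_one x).1 hx
      have hxa' := abs_lt.1 hxa
      filter_upwards [Ioo_mem_nhdsGT (lt_min hδ (sub_pos.2 hxa))] with t ht
      have ht1 := ht.2.trans_le (min_le_left _ _)
      have ht2 := ht.2.trans_le (min_le_right _ _)
      have ht3 : t * phi x ≤ t := mul_le_of_le_one_right ht.1.le hφ1
      refine ⟨t, ht.1, ht1.le, (max_eq_right (mul_nonneg ht.1.le hφ)).symm, ?_, ?_⟩
      · linarith [le_abs_self x]
      · linarith [neg_abs_le x]
  · have hpos : 0 < phi x := by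
      by_contra h
      have : phi x = 0 := le_antisymm (not_lt.1 h) hφ
      rw [this, zero_mul] at haδ
      linarith
    filter_upwards [Ioo_mem_nhdsGT ha] with t ht
    have ht3 : t * phi x ≤ a := (mul_le_of_le_one_right ht.1.le hφ1).trans ht.2.le
    have e : a / phi x * phi x = a := div_mul_cancel₀ _ hpos.ne'
    refine ⟨a / phi x, by positivity, ?_, ?_, ?_, ?_⟩
    · rw [div_le_iff₀ hpos]; linarith
    · rw [e, max_eq_left ht3]
    · rw [e]; exact hx1
    · rw [e]; exact hx2

/-- Extension of a function on the square to the plane. -/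
noncomputable def squareExtend (f : C(Square, ℝ)) (x y : ℝ) : ℝ :=
  f (Set.projIcc (-1 : ℝ) 1 (by norm_num) x, Set.projIcc (-1 : ℝ) 1 (by norm_num) y)

lemma squareExtend_coe (f : C(Square, ℝ)) (p : Square) : squareExtend f p.1 p.2 = f p := by
  simp [squareExtend]

lemma continuous_squareExtend (f : C(Square, ℝ)) :
    Continuous fun p : ℝ × ℝ => squareExtend f p.1 p.2 :=
  f.continuous.comp ((continuous_projIcc.comp continuous_fst).prodMk
    (continuous_projIcc.comp continuous_snd))

open Filter Topology in
/-- The modulus bounds all second differences with steps `a ≤ φ(x) δ₁`, `b ≤ φ(y) δ₂`, where `a`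
and `b` may vanish. -/
lemma abs_secondDifference_le_modulus (f : C(Square, ℝ)) {x y a b δ₁ δ₂ : ℝ}
    (hδ₁ : 0 < δ₁) (hδ₂ : 0 < δ₂) (ha : 0 ≤ a) (hb : 0 ≤ b)
    (haδ : a ≤ phi x * δ₁) (hbδ : b ≤ phi y * δ₂)
    (hx1 : x + a ≤ 1) (hx2 : -1 ≤ x - a) (hy1 : y + b ≤ 1) (hy2 : -1 ≤ y - b) :
    |squareExtend f (x + a) (y + b) - 2 * squareExtend f x y + squareExtend f (x - a) (y - b)| ≤
      modulus 2 f δ₁ δ₂ := by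
  have hF := continuous_squareExtend f
  -- The modulus only admits positive `h₁` and `h₂`, so a vanishing displacement is approached by `t
  -- φ` with `t → 0+`; continuity of `f` passes the bound to the limit `G 0`.
  set G : ℝ → ℝ := fun t => |squareExtend f (x + max a (t * phi x)) (y + max b (t * phi y)) -
    2 * squareExtend f x y +
    squareExtend f (x - max a (t * phi x)) (y - max b (t * phi y))| with hG
  have hGc : Continuous G := by
    have c1 : Continuous fun t => squareExtend f (x + max a (t * phi x)) (y + max b (t * phi y)) :=
      hF.comp (by fun_prop : Continuous fun t : ℝ =>
        (x + max a (t * phi x), y + max b (t * phi y)))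
    have c2 : Continuous fun t => squareExtend f (x - max a (t * phi x)) (y - max b (t * phi y)) :=
      hF.comp (by fun_prop : Continuous fun t : ℝ =>
        (x - max a (t * phi x), y - max b (t * phi y)))
    exact ((c1.sub continuous_const).add c2).abs
  have hG0 : Tendsto G (𝓝[>] 0) (𝓝 (G 0)) := hGc.continuousAt.tendsto.mono_left nhdsWithin_le_nhds
  have hle : ∀ᶠ t in 𝓝[>] (0 : ℝ), G t ≤ modulus 2 f δ₁ δ₂ := by
    filter_upwards [eventually_exists_step hδ₁ ha haδ hx1 hx2,
      eventually_exists_step hδ₂ hb hbδ hy1 hy2] with t ⟨h, h0, hδ, he, h1, h2⟩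
      ⟨k, k0, kδ, ke, k1, k2⟩
    have := abs_symmDifference_le_modulus f
      (⟨⟨x, by linarith, by linarith⟩, ⟨y, by linarith, by linarith⟩⟩ : Square) h0 hδ k0 kδ
    rw [symmDifference_two_of_mem h1 h2 k1 k2 h0.le k0.le] at this
    simp only [he, ke] at this
    exact this
  have := le_of_tendsto hG0 hle
  simpa only [hG, zero_mul, max_eq_left ha, max_eq_left hb] using this

lemma secondDifferencesLE_fst (f : C(Square, ℝ)) {m n : ℕ} (hm : 1 ≤ m) (hn : 1 ≤ n) {y : ℝ}
    (hy : y ∈ Set.Icc (-1 : ℝ) 1) :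
    SecondDifferencesLE m (fun x => squareExtend f x y) (modulus 2 f (1 / m) (1 / n)) := by
  intro x η h0 h1 h2 h3
  have hm' : (0 : ℝ) < m := by exact_mod_cast hm
  have hn' : (0 : ℝ) < n := by exact_mod_cast hn
  have := abs_secondDifference_le_modulus f (x := x) (y := y) (a := η) (b := 0)
    (one_div_pos.2 hm') (one_div_pos.2 hn') h0 le_rfl (by rwa [mul_one_div])
    (mul_nonneg (phi_nonneg y) (one_div_pos.2 hn').le) h3 h2 (by simpa using hy.2)
    (by simpa using hy.1)
  simpa only [add_zero, sub_zero] using this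

lemma secondDifferencesLE_snd (f : C(Square, ℝ)) {m n : ℕ} (hm : 1 ≤ m) (hn : 1 ≤ n) {x : ℝ}
    (hx : x ∈ Set.Icc (-1 : ℝ) 1) :
    SecondDifferencesLE n (fun y => squareExtend f x y) (modulus 2 f (1 / m) (1 / n)) := by
  intro y η h0 h1 h2 h3
  have hm' : (0 : ℝ) < m := by exact_mod_cast hm
  have hn' : (0 : ℝ) < n := by exact_mod_cast hn
  have := abs_secondDifference_le_modulus f (x := x) (y := y) (a := 0) (b := η)
    (one_div_pos.2 hm') (one_div_pos.2 hn') le_rfl h0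
    (mul_nonneg (phi_nonneg x) (one_div_pos.2 hm').le) (by rwa [mul_one_div])
    (by simpa using hx.2) (by simpa using hx.1) h3 h2
  simpa only [add_zero, sub_zero] using this

/-! ### The Jackson estimate on the square -/

open Polynomial in
lemma sum_eval_mul_eval_mem_polyCoord {m n : ℕ} {ι : Type} [Fintype ι] (c : ι → ℝ)
    (B D : ι → ℝ[X]) (hB : ∀ q, (B q).natDegree ≤ m) (hD : ∀ q, (D q).natDegree ≤ n)
    {p : C(Square, ℝ)}
    (hp : ∀ v : Square, p v = ∑ q, c q * ((B q).eval (v.1 : ℝ) * (D q).eval (v.2 : ℝ))) :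
    p ∈ polyCoord m n := by
  refine ⟨fun i j => ∑ q, c q * ((B q).coeff i * (D q).coeff j), fun v => ?_⟩
  have h : ∀ q, c q * ((B q).eval (v.1 : ℝ) * (D q).eval (v.2 : ℝ)) =
      ∑ i ∈ Finset.range (m + 1), ∑ j ∈ Finset.range (n + 1),
        c q * ((B q).coeff i * (D q).coeff j) * (v.1 : ℝ) ^ i * (v.2 : ℝ) ^ j := fun q => by
    rw [eval_eq_sum_range' (Nat.lt_succ_of_le (hB q)),
      eval_eq_sum_range' (Nat.lt_succ_of_le (hD q)), Finset.sum_mul_sum, Finset.mul_sum]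
    refine Finset.sum_congr rfl fun i _ => ?_
    rw [Finset.mul_sum]
    exact Finset.sum_congr rfl fun j _ => by ring
  rw [hp]
  simp_rw [h, Finset.sum_mul]
  rw [Finset.sum_comm]
  exact Finset.sum_congr rfl fun i _ => Finset.sum_comm

/-- Jackson type estimate for approximation by polynomials of coordinate degree `(m, n)`. -/
theorem exists_mem_polyCoord_norm_sub_le : ∃ K : ℝ, 0 < K ∧ ∀ m n : ℕ, 1 ≤ m → 1 ≤ n →
    ∀ f : C(Square, ℝ), ∃ p ∈ polyCoord m n,
      ‖f - p‖ ≤ K * modulus 2 f (1 / (m : ℝ)) (1 / (n : ℝ)) := by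
  obtain ⟨c, hc, H⟩ := exists_linear_approximation
  -- With `A`, `A'` the operators in `x` and `y`, `p = A A' f` and `g = f - A' f`, one has `f - p =
  -- (f - A f) + g - (g - A g)`. The three terms are at most `c ω`, `c ω` and `4 c² ω`.
  refine ⟨2 * c + 4 * c ^ 2, by positivity, fun m n hm hn f => ?_⟩
  obtain ⟨ι, _, z, B, hz, hB, hA⟩ := H m hm
  obtain ⟨κ, _, w, D, hw, hD, hA'⟩ := H n hn
  set ω := modulus 2 f (1 / (m : ℝ)) (1 / (n : ℝ)) with hω
  have hω0 : 0 ≤ ω := modulus_nonneg f _ _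
  set F := squareExtend f with hF
  have hFc : Continuous fun p : ℝ × ℝ => F p.1 p.2 := continuous_squareExtend f
  have hF1 : ∀ y, Continuous fun x => F x y := fun y =>
    hFc.comp (by fun_prop : Continuous fun x : ℝ => (x, y))
  have hF2 : ∀ x, Continuous fun y => F x y := fun x =>
    hFc.comp (by fun_prop : Continuous fun y : ℝ => (x, y))
  let p : C(Square, ℝ) := ⟨fun v => ∑ q : ι × κ, F (z q.1) (w q.2) *
    ((B q.1).eval (v.1 : ℝ) * (D q.2).eval (v.2 : ℝ)), by fun_prop⟩
  refine ⟨p, sum_eval_mul_eval_mem_polyCoord (fun q : ι × κ => F (z q.1) (w q.2))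
    (fun q => B q.1) (fun q => D q.2) (fun q => hB q.1) (fun q => hD q.2) fun v => rfl, ?_⟩
  rw [ContinuousMap.norm_le _ (by positivity)]
  rintro ⟨⟨x, hx⟩, ⟨y, hy⟩⟩
  set g : ℝ → ℝ := fun s => F s y - ∑ k, F s (w k) * (D k).eval y with hg
  have hgc : Continuous g := (hF1 y).sub
    (continuous_finsetSum _ fun k _ => (hF1 (w k)).mul continuous_const)
  have hgb : ∀ s ∈ Set.Icc (-1 : ℝ) 1, |g s| ≤ c * ω := fun s hs =>
    hA' (fun y => F s y) ω hω0 (hF2 s).continuousOn (secondDifferencesLE_snd f hm hn hs) y hy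
  -- Smoothness of `g` is not needed: its second differences are at most four times its bound. This
  -- replaces an operator norm estimate for `A`.
  have hgd : SecondDifferencesLE m g (4 * (c * ω)) := by
    intro s η h0 _ h2 h3
    refine (abs_add_le _ _).trans ?_
    have b1 := hgb (s + η) ⟨by linarith, h3⟩
    have b2 := hgb s ⟨by linarith, by linarith⟩
    have b3 := hgb (s - η) ⟨h2, by linarith⟩
    have b4 := abs_sub (g (s + η)) (2 * g s)
    rw [abs_mul, abs_two] at b4
    linarith
  have e1 := hA g (4 * (c * ω)) (by positivity) hgc.continuousOn hgd x hx
  have e2 := hA (fun x => F x y) ω hω0 (hF1 y).continuousOn (secondDifferencesLE_fst f hm hn hy)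
    x hx
  have e3 := hgb x hx
  have hp : p (⟨x, hx⟩, ⟨y, hy⟩) = ∑ i, F (z i) y * (B i).eval x - ∑ i, g (z i) * (B i).eval x := by
    rw [← Finset.sum_sub_distrib]
    change ∑ q : ι × κ, F (z q.1) (w q.2) * ((B q.1).eval x * (D q.2).eval y) = _
    rw [Fintype.sum_prod_type]
    refine Finset.sum_congr rfl fun i _ => ?_
    rw [← sub_mul]
    simp only [hg]
    rw [sub_sub_cancel, Finset.sum_mul]
    exact Finset.sum_congr rfl fun k _ => by ring
  have hfx : f (⟨x, hx⟩, ⟨y, hy⟩) = F x y := (squareExtend_coe f (⟨x, hx⟩, ⟨y, hy⟩)).symm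
  rw [ContinuousMap.sub_apply, hp, hfx, Real.norm_eq_abs]
  rw [abs_le] at *
  constructor <;> nlinarith

lemma polyCoord_subset_polyTotal (m n : ℕ) : polyCoord m n ⊆ polyTotal m n := by
  rintro p ⟨a, ha⟩
  refine ⟨∑ i ∈ Finset.range (m + 1), ∑ j ∈ Finset.range (n + 1),
    MvPolynomial.C (a i j) * MvPolynomial.X 0 ^ i * MvPolynomial.X 1 ^ j, ?_, fun q => ?_⟩
  · refine MvPolynomial.totalDegree_finsetSum_le fun i hi => ?_
    refine MvPolynomial.totalDegree_finsetSum_le fun j hj => ?_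
    have hi := Finset.mem_range.1 hi
    have hj := Finset.mem_range.1 hj
    refine (MvPolynomial.totalDegree_mul _ _).trans ?_
    refine (add_le_add_left (MvPolynomial.totalDegree_mul _ _) _).trans ?_
    rw [MvPolynomial.totalDegree_C, MvPolynomial.totalDegree_X_pow,
      MvPolynomial.totalDegree_X_pow]
    omega
  · rw [ha]
    simp [map_sum]

/-! ### The fractal perturbation and the conclusion -/

/-- The cells cover the square, so the self-referential equation yields `‖g - p‖ ≤ ‖α‖ (‖g - p‖ + ‖p
- L p‖)`, which can be solved for `‖g - p‖` as `‖α‖ < 1`. -/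
lemma norm_fractalOperator_sub_le (X Y : Grid) (α : C(Square, ℝ)) (hα : ‖α‖ < 1)
    (L : C(Square, ℝ) →L[ℝ] C(Square, ℝ)) (hL : InterpolatesCorners L) (p : C(Square, ℝ)) :
    ‖fractalOperator X Y α L hα hL p - p‖ ≤
      ‖α‖ * ‖ContinuousLinearMap.id ℝ C(Square, ℝ) - L‖ / (1 - ‖α‖) * ‖p‖ := by
  set g := fractalOperator X Y α L hα hL p with hg
  have hspec : IsAlphaFractal X Y α L p g :=
    (existsUnique_isAlphaFractal X Y α L hα hL p).choose_spec.1
  have hself := (graph_eq_iff X Y α L p g).1 hspec.2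
  have hLp : ‖p - L p‖ ≤ ‖ContinuousLinearMap.id ℝ C(Square, ℝ) - L‖ * ‖p‖ :=
    (ContinuousLinearMap.id ℝ C(Square, ℝ) - L).le_opNorm p
  have hle : ‖g - p‖ ≤ ‖α‖ * (‖g - p‖ + ‖p - L p‖) := by
    rw [ContinuousMap.norm_le _ (by positivity)]
    rintro ⟨s, t⟩
    obtain ⟨i, x, rfl⟩ := X.cellMap_surjective s
    obtain ⟨j, y, rfl⟩ := Y.cellMap_surjective t
    have h := hself i j (x, y)
    rw [ifsHeight] at h
    change ‖(g - p) (cell X Y i j (x, y))‖ ≤ _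
    have e : (g - p) (cell X Y i j (x, y)) =
        α (cell X Y i j (x, y)) * ((g - p) (x, y) + (p - L p) (x, y)) := by
      simp only [ContinuousMap.sub_apply]
      rw [h]; ring
    rw [e, norm_mul]
    refine mul_le_mul (α.norm_coe_le_norm _) ((norm_add_le _ _).trans ?_) (norm_nonneg _)
      (norm_nonneg _)
    exact add_le_add ((g - p).norm_coe_le_norm _) ((p - L p).norm_coe_le_norm _)
  have h1 : 0 < 1 - ‖α‖ := by linarith
  rw [div_mul_eq_mul_div, le_div_iff₀ h1]
  have := mul_le_mul_of_nonneg_left hLp (norm_nonneg α)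
  linarith

lemma approxError_le {V : Set C(Square, ℝ)} {f g : C(Square, ℝ)} (hg : g ∈ V) :
    approxError V f ≤ ‖f - g‖ := by
  refine csInf_le ⟨0, ?_⟩ ⟨g, hg, rfl⟩
  rintro _ ⟨g, -, rfl⟩
  exact norm_nonneg _

theorem mainTheorem10 :
    ∃ C : ℝ, 0 < C ∧
      ∀ (X Y : Grid) (α : C(Square, ℝ)) (hα : ‖α‖ < 1)
        (L : C(Square, ℝ) →L[ℝ] C(Square, ℝ)) (hL : InterpolatesCorners L)
        (m n : ℕ) (_ : 1 ≤ m) (_ : 1 ≤ n) (f : C(Square, ℝ)),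
        approxError (fractalOperator X Y α L hα hL '' polyCoord m n) f ≤
            C * ((1 + ‖α‖ * (‖ContinuousLinearMap.id ℝ C(Square, ℝ) - L‖ - 1)) / (1 - ‖α‖)) *
                modulus 2 f (1 / (m : ℝ)) (1 / (n : ℝ)) +
              ‖α‖ * ‖ContinuousLinearMap.id ℝ C(Square, ℝ) - L‖ / (1 - ‖α‖) * ‖f‖ ∧
        approxError (fractalOperator X Y α L hα hL '' polyTotal m n) f ≤
            C * ((1 + ‖α‖ * (‖ContinuousLinearMap.id ℝ C(Square, ℝ) - L‖ - 1)) / (1 - ‖α‖)) *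
                modulus 2 f (1 / (m : ℝ)) (1 / (n : ℝ)) +
              ‖α‖ * ‖ContinuousLinearMap.id ℝ C(Square, ℝ) - L‖ / (1 - ‖α‖) * ‖f‖ := by
  obtain ⟨K, hK, H⟩ := exists_mem_polyCoord_norm_sub_le
  refine ⟨K, hK, fun X Y α hα L hL m n hm hn f => ?_⟩
  obtain ⟨p, hp, hfp⟩ := H m n hm hn f
  have hfr := norm_fractalOperator_sub_le X Y α hα L hL p
  set g := fractalOperator X Y α L hα hL p
  set D := ‖ContinuousLinearMap.id ℝ C(Square, ℝ) - L‖
  set ω := modulus 2 f (1 / (m : ℝ)) (1 / (n : ℝ))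
  have h1 : 0 < 1 - ‖α‖ := by linarith
  have hD : 0 ≤ ‖α‖ * D / (1 - ‖α‖) :=
    div_nonneg (mul_nonneg (norm_nonneg α)
      (norm_nonneg (ContinuousLinearMap.id ℝ C(Square, ℝ) - L))) h1.le
  have hpn : ‖p‖ ≤ ‖f‖ + K * ω := by
    have := norm_sub_norm_le p f
    rw [norm_sub_rev] at this
    linarith
  have hfg : ‖f - g‖ ≤ ‖f - p‖ + ‖g - p‖ := by
    rw [norm_sub_rev g p]
    exact norm_sub_le_norm_sub_add_norm_sub f p g
  have hcoef : (1 + ‖α‖ * (D - 1)) / (1 - ‖α‖) = 1 + ‖α‖ * D / (1 - ‖α‖) := by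
    field_simp; ring
  have hmain : ‖f - g‖ ≤ K * ((1 + ‖α‖ * (D - 1)) / (1 - ‖α‖)) * ω +
      ‖α‖ * D / (1 - ‖α‖) * ‖f‖ := by
    rw [hcoef]
    have := mul_le_mul_of_nonneg_left hpn hD
    linarith
  exact ⟨(approxError_le (Set.mem_image_of_mem _ hp)).trans hmain,
    (approxError_le (Set.mem_image_of_mem _ (polyCoord_subset_polyTotal m n hp))).trans hmain⟩
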